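/- Let $X$ be a compact metrizable space, $\mu_0$ a Borel probability measure on $X$, and for each $N\ge 1$ let $H^{(N)}:X^N\to[-\infty,\infty]$ be a symmetric $\mu_0^{\otimes N}$-measurable function. Let $\mathcal P(X)$ be the space of Borel probability measures on $X$ with the weak topology, $\delta_N(x_1,\dots,x_N)=\frac1N\sum_{i=1}^N\delta_{x_i}\in\mathcal P(X)$, and for $\beta\in\mathbb R$ $$Z_{N,\beta}=\int_{X^N}e^{-\beta H^{(N)}}\,\mu_0^{\otimes N}\in[0,\infty].$$ For a probability measure $\mu^{(N)}$ on $X^N$ let $E^{(N)}(\mu^{(N)})=\frac1N\int_{X^N}H^{(N)}\,\mu^{(N)}$ (read as $+\infty$ if the positive part of $H^{(N)}$ is not $\mu^{(N)}$-integrable or the integral is undefined; the same convention applies to $\int E\,\Gamma$ below) and $D^{(N)}(\mu^{(N)})=\frac1N D(\mu^{(N)},\mu_0^{\otimes N})$, where $D(\nu_1,\nu_2)=\int\log\frac{d\nu_1}{d\nu_2}\,\nu_1$ if $\nu_1\ll\nu_2$ and $D(\nu_1,\nu_2)=\infty$ otherwise; write $D_{\mu_0}(\mu)=D(\mu,\mu_0)$.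 Let $E:\mathcal P(X)\to[-\infty,\infty]$ satisfy: - (H1) $\lim_{N\to\infty}E^{(N)}(\mu^{\otimes N})=E(\mu)$ for every $\mu\in\mathcal P(X)$ with $E(\mu)<\infty$; moreover $E(\mu_0)<\infty$. - (H4) If $\mu^{(N)}$, $N\ge1$, are symmetric probability measures on $X^N$ with $E^{(N)}(\mu^{(N)})\le C$ and $D^{(N)}(\mu^{(N)})\le C$ for some constant $C$ and all $N$, then along every subsequence for which the laws $(\delta_N)_*\mu^{(N)}$ converge weakly to some $\Gamma\in\mathcal P(\mathcal P(X))$, one has $E^{(N)}(\mu^{(N)})\to\int_{\mathcal P(X)}E(\mu)\,\Gamma(\mu)$. Fix a real number $\beta_0<0$. Then the following are equivalent: (a) for every $\beta>\beta_0$ there is a constant $C_\beta$ such that $Z_{N,\beta}\le C_\beta^N$ for all $N\ge 1$; (b) for every $\beta>\beta_0$ the measures $(\delta_N)_*\big(e^{-\beta H^{(N)}}\mu_0^{\otimes N}\big)$ on $\mathcal P(X)$ are finite (i.e. $Z_{N,\beta}<\infty$ for all $N\ge1$) and satisfy, as $N\to\infty$, a large deviation principle with speed $N$ and rate functional $I=\beta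 E+D_{\mu_0}$, where $I(\mu)=+\infty$ whenever $D_{\mu_0}(\mu)=\infty$ (and $0\cdot(\pm\infty)=0$). That is, writing $\Gamma_N$ for these measures: $I$ is lower semicontinuous with values in $]-\infty,\infty]$, $\limsup_{N}\frac1N\log\Gamma_N(\mathcal F)\le-\inf_{\mathcal F}I$ for every closed $\mathcal F\subset\mathcal P(X)$, and $\liminf_{N}\frac1N\log\Gamma_N(\mathcal G)\ge-\inf_{\mathcal G}I$ for every open $\mathcal G\subset\mathcal P(X)$. -/

import Mathlib

open MeasureTheory Filter Topology Set
open scoped ENNReal NNReal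

namespace GibbsLDP

/-! ### The Borel structure of the space of probability measures -/

section Borel

variable {X : Type*} [TopologicalSpace X] [CompactSpace X] [TopologicalSpace.MetrizableSpace X]
  [MeasurableSpace X] [BorelSpace X]

/-- On a compact metrizable space, the `σ`-algebra on `𝒫(X)` generated by the evaluations
`μ ↦ μ s` is the Borel `σ`-algebra of the weak topology. -/
instance instBorelSpaceProbabilityMeasure : BorelSpace (ProbabilityMeasure X) := by
  refine ⟨le_antisymm ?_ ?_⟩
  · have hm : @Measurable (ProbabilityMeasure X) (Measure X) (borel _) _
        (fun μ => (μ : Measure X)) := by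
      let m : MeasurableSpace (ProbabilityMeasure X) := borel _
      have : @BorelSpace (ProbabilityMeasure X) _ m := @BorelSpace.mk _ _ m rfl
      refine Measurable.measure_of_isPiSystem_of_isProbabilityMeasure
        (S := {s : Set X | IsOpen s}) (BorelSpace.measurable_eq (α := X)) isPiSystem_isOpen ?_
      intro s hs
      apply LowerSemicontinuous.measurable
      rw [lowerSemicontinuous_iff_le_liminf]
      intro μ
      exact ProbabilityMeasure.le_liminf_measure_open_of_tendsto tendsto_id hs
    exact measurable_iff_comap_le.mp hm
  · have ht : (inferInstance : TopologicalSpace (ProbabilityMeasure X)) =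
        TopologicalSpace.generateFrom
          {V | ∃ (f : BoundedContinuousFunction X ℝ≥0) (O : Set ℝ≥0∞), IsOpen O ∧
            V = (fun μ : ProbabilityMeasure X => ∫⁻ x, f x ∂(μ : Measure X)) ⁻¹' O} := by
      refine le_antisymm (le_generateFrom ?_) ?_
      · rintro V ⟨f, O, hO, rfl⟩
        exact hO.preimage (ProbabilityMeasure.continuous_lintegral_boundedContinuousFunction f)
      · rw [← continuous_id_iff_le]
        let t' : TopologicalSpace (ProbabilityMeasure X) := TopologicalSpace.generateFrom
          {V | ∃ (f : BoundedContinuousFunction X ℝ≥0) (O : Set ℝ≥0∞), IsOpen O ∧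
            V = (fun μ : ProbabilityMeasure X => ∫⁻ x, f x ∂(μ : Measure X)) ⁻¹' O}
        refine (@ProbabilityMeasure.continuous_iff_forall_continuous_lintegral X _ _ _
          (ProbabilityMeasure X) t' id).2 fun f => ?_
        exact ⟨fun O hO => TopologicalSpace.isOpen_generateFrom_of_mem ⟨f, O, hO, rfl⟩⟩
    rw [borel_eq_generateFrom_of_subbasis ht]
    refine MeasurableSpace.generateFrom_le ?_
    rintro V ⟨f, O, hO, rfl⟩
    have hf : Measurable fun x : X => (f x : ℝ≥0∞) := by
      exact (ENNReal.continuous_coe.comp f.continuous).measurable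
    exact ((Measure.measurable_lintegral hf).comp measurable_subtype_coe) hO.measurableSet

end Borel

/-! ### Integrals of extended-real functions -/

/-- The integral `∫ f dμ ∈ [-∞, ∞]` of an extended-real function, `∫ f⁺ dμ - ∫ f⁻ dμ`. It is
set to `+∞` when `∫ f⁺ dμ = ∞`, in particular when it is undefined because of `∞ - ∞`, and also
when `f` is not `μ`-measurable; so a value `< ∞` means that the integral is well defined. -/
noncomputable def extIntegral {Ω : Type*} [MeasurableSpace Ω] (f : Ω → EReal) (μ : Measure Ω) :
    EReal :=
  open Classical in
  if AEMeasurable f μ ∧ ∫⁻ ω, (f ω).toENNReal ∂μ ≠ ∞ then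
    ((∫⁻ ω, (f ω).toENNReal ∂μ : ℝ≥0∞) : EReal) - ((∫⁻ ω, (-f ω).toENNReal ∂μ : ℝ≥0∞) : EReal)
  else ⊤

/-! ### Large deviation principles -/

/-- The measures `Γ N` on `Y` satisfy a large deviation principle with speed `r N` and rate
functional `I : Y → ]-∞, ∞]`, which is required to be lower semicontinuous. The measures need not
be normalized. Here `log 0 = -∞` and `log ∞ = ∞`. -/
structure SatisfiesLDP {Y : Type*} [TopologicalSpace Y] [MeasurableSpace Y]
    (Γ : ℕ+ → Measure Y) (r : ℕ+ → ℝ) (I : Y → EReal) : Prop where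
  lowerSemicontinuous : LowerSemicontinuous I
  ne_bot : ∀ y, I y ≠ ⊥
  upper_bound : ∀ F : Set Y, IsClosed F →
    limsup (fun N => ENNReal.log (Γ N F) / (r N : EReal)) atTop ≤ -(⨅ y ∈ F, I y)
  lower_bound : ∀ G : Set Y, IsOpen G →
    -(⨅ y ∈ G, I y) ≤ liminf (fun N => ENNReal.log (Γ N G) / (r N : EReal)) atTop

/-! ### Particle systems -/

section Particles

variable {X : Type*} [MeasurableSpace X]

/-- The `N`-fold product `μ^{⊗N}` on `X^N`. -/
noncomputable def prodMeasure (N : ℕ+) (μ : ProbabilityMeasure X) :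
    ProbabilityMeasure (Fin N → X) :=
  ⟨Measure.pi fun _ => (μ : Measure X), inferInstance⟩

/-- The empirical measure `δ_N(x₁, …, x_N) = (1/N) ∑ δ_{x_i}`. -/
noncomputable def empiricalMeasure (N : ℕ+) (x : Fin N → X) : ProbabilityMeasure X :=
  ⟨((N : ℕ) : ℝ≥0∞)⁻¹ • ∑ i, Measure.dirac (x i), ⟨by
    simp [ENNReal.inv_mul_cancel (a := ((N : ℕ) : ℝ≥0∞)) (by simp) (by simp)]⟩⟩

theorem measurable_empiricalMeasure (N : ℕ+) :
    Measurable (empiricalMeasure N : (Fin N → X) → ProbabilityMeasure X) := by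
  refine Measurable.subtype_mk (Measure.measurable_of_measurable_coe _ fun s hs => ?_)
  simp only [Measure.smul_apply, Measure.coe_finsetSum, Finset.sum_apply, smul_eq_mul]
  refine Measurable.const_mul (Finset.measurable_sum _ fun i _ => ?_) _
  exact (Measure.measurable_coe hs).comp (Measure.measurable_dirac.comp (measurable_pi_apply i))

/-- The law `(δ_N)_* μ^{(N)}` on `𝒫(X)` of the empirical measure under `μ^{(N)}`. -/
noncomputable def empiricalLaw (N : ℕ+) (μN : ProbabilityMeasure (Fin N → X)) :
    ProbabilityMeasure (ProbabilityMeasure X) :=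
  μN.map (measurable_empiricalMeasure N).aemeasurable

/-- Symmetric (permutation invariant) probability measures on `X^N`. -/
def IsSymmetric {N : ℕ+} (μN : ProbabilityMeasure (Fin N → X)) : Prop :=
  ∀ σ : Equiv.Perm (Fin N), (μN : Measure (Fin N → X)).map (fun x => x ∘ σ) = μN

/-- The mean energy `E^{(N)}(μ^{(N)}) = (1/N) ∫ H^{(N)} dμ^{(N)}`. -/
noncomputable def meanEnergy (H : (N : ℕ+) → (Fin N → X) → EReal) (N : ℕ+)
    (μN : ProbabilityMeasure (Fin N → X)) : EReal :=
  extIntegral (H N) (μN : Measure (Fin N → X)) / ((N : ℕ) : EReal)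

/-- The relative entropy `D(ν₁, ν₂) ∈ [0, ∞]` of probability measures: `∫ log (dν₁/dν₂) dν₁` if
`ν₁ ≪ ν₂`, and `∞` otherwise. -/
noncomputable def relEntropy {Z : Type*} [MeasurableSpace Z] (ν₁ ν₂ : ProbabilityMeasure Z) :
    ℝ≥0∞ :=
  InformationTheory.klDiv (ν₁ : Measure Z) (ν₂ : Measure Z)

/-- The mean entropy `D^{(N)}(μ^{(N)}) = (1/N) D(μ^{(N)}, μ₀^{⊗N})`. -/
noncomputable def meanEntropy (μ₀ : ProbabilityMeasure X) (N : ℕ+)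
    (μN : ProbabilityMeasure (Fin N → X)) : EReal :=
  (relEntropy μN (prodMeasure N μ₀) : EReal) / ((N : ℕ) : EReal)

/-- The unnormalized Gibbs measure `e^{-β H^{(N)}} μ₀^{⊗N}` on `X^N`. -/
noncomputable def boltzmannMeasure (μ₀ : ProbabilityMeasure X)
    (H : (N : ℕ+) → (Fin N → X) → EReal) (β : ℝ) (N : ℕ+) : Measure (Fin N → X) :=
  (prodMeasure N μ₀ : Measure (Fin N → X)).withDensity fun x => EReal.exp (-((β : EReal) * H N x))

/-- The partition function `Z_{N,β} = ∫ e^{-β H^{(N)}} dμ₀^{⊗N} ∈ [0, ∞]`. -/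
noncomputable def partitionFunction (μ₀ : ProbabilityMeasure X)
    (H : (N : ℕ+) → (Fin N → X) → EReal) (β : ℝ) (N : ℕ+) : ℝ≥0∞ :=
  ∫⁻ x, EReal.exp (-((β : EReal) * H N x)) ∂(prodMeasure N μ₀ : Measure (Fin N → X))

/-- The functional `β F_β(μ) = β E(μ) + D_{μ₀}(μ)`, equal to `+∞` whenever `D_{μ₀}(μ) = ∞`. -/
noncomputable def scaledFreeEnergy (μ₀ : ProbabilityMeasure X) (E : ProbabilityMeasure X → EReal)
    (β : ℝ) (μ : ProbabilityMeasure X) : EReal :=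
  open Classical in
  if relEntropy μ μ₀ = ∞ then ⊤ else (β : EReal) * E μ + (relEntropy μ μ₀ : EReal)

/-- `E` is a macroscopic mean energy of the Hamiltonians `H^{(N)}`: for every `μ` with
`E(μ) < ∞` the mean energies of `μ^{⊗N}` converge to `E(μ)`, and `E(μ₀) < ∞`. -/
structure HasMacroscopicMeanEnergy (μ₀ : ProbabilityMeasure X) (H : (N : ℕ+) → (Fin N → X) → EReal)
    (E : ProbabilityMeasure X → EReal) : Prop where
  tendsto_meanEnergy : ∀ μ : ProbabilityMeasure X, E μ < ⊤ →
    Tendsto (fun N => meanEnergy H N (prodMeasure N μ)) atTop (𝓝 (E μ))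
  base_lt_top : E μ₀ < ⊤

/-- Mean energy/entropy compactness: if the symmetric probability measures
`μ^{(N)}` have bounded mean energy and bounded mean entropy, then along any subsequence for which
the laws `(δ_N)_* μ^{(N)}` converge weakly to some `Γ`, the mean energies converge to
`∫ E(μ) Γ(μ)`. -/
def EnergyEntropyCompact [TopologicalSpace X] [CompactSpace X] [TopologicalSpace.MetrizableSpace X]
    [BorelSpace X] (μ₀ : ProbabilityMeasure X) (H : (N : ℕ+) → (Fin N → X) → EReal)
    (E : ProbabilityMeasure X → EReal) : Prop :=
  ∀ (C : ℝ) (μ : (N : ℕ+) → ProbabilityMeasure (Fin N → X)),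
    (∀ N, IsSymmetric (μ N)) →
    (∀ N, meanEnergy H N (μ N) ≤ (C : EReal)) →
    (∀ N, meanEntropy μ₀ N (μ N) ≤ (C : EReal)) →
    ∀ (φ : ℕ → ℕ+), StrictMono φ → ∀ Γ : ProbabilityMeasure (ProbabilityMeasure X),
      Tendsto (fun k => empiricalLaw (φ k) (μ (φ k))) atTop (𝓝 Γ) →
      Tendsto (fun k => meanEnergy H (φ k) (μ (φ k))) atTop
        (𝓝 (extIntegral E (Γ : Measure (ProbabilityMeasure X))))

end Particles

end GibbsLDP

/-!
The theorem rests on the Gibbs variational principle on `X^N`: for a probability measure `ν` of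
finite relative entropy with respect to `μ₀^{⊗N}` and an event `A` that carries `ν`,
`-(1/N) log ∫_A e^{-βH} ≤ β e(ν) + d(ν)`, where `e` and `d` are the mean energy and the mean
entropy, with equality for the Gibbs measure conditioned on `A`
(`ExponentialBound.neg_log_div_le`, `exists_gibbs_measure`).

Assume the exponential bounds on `Z_{N,β}`. The variational inequality at the inverse
temperatures `β₀ / 2` and `1` bounds the energy on both sides by the entropy, and at a `β'` beyond
`β` it bounds the entropy by the free energy at `β`
(`ExponentialBound.exists_realEntropy_le`); this is where the bounds on a whole
half-line `β > β₀` with `β₀ < 0` enter. Hence a bound on the mean free energies gives both bounds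
needed for energy/entropy compactness, so along converging empirical laws the energies converge to
`∫ E dΓ` (`tendsto_realEnergy`). The mean entropies satisfy `liminf d ≥ ∫ D_{μ₀} dΓ`: the relative
entropy is the supremum of the functionals `a_f(μ) = ∫ f dμ - ∫ (e^f - 1) dμ₀` with `f` continuous
(`klDiv_le_iSup_entropyApprox`), and `∫ e^{N a_f(δ_N)} dμ₀^{⊗N} ≤ 1`, so the variational inequality
for `N max_j a_{f_j}(δ_N)` costs only `log (n + 2)` (`lintegral_iSup_entropyApprox_le`). Together,
if mean free energies are asymptotically at most `c`, every limit `Γ` charges measures of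
macroscopic free energy at most `c` (`exists_scaledFreeEnergy_le`).

This one fact gives the upper bound, applied to Gibbs measures conditioned on `δ_N ∈ F`, and the
lower semicontinuity of the rate functional, applied to a diagonal sequence of product measures.
The lower bound is the variational inequality for `μ^{⊗N}` conditioned on `δ_N ∈ G`: its empirical
laws converge to the Dirac mass at `μ`, its energies converge to `E(μ)`, and its
entropies are asymptotically at most `D_{μ₀}(μ)`.

Conversely, a lower semicontinuous functional without the value `-∞` is bounded below on the compact
space `𝒫(X)`, so the upper bound for the whole space bounds `(1/N) log Z_{N,β}` for large `N`.
-/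

namespace GibbsLDP

set_option linter.unusedSectionVars false

/-! ### Relative entropy -/

section RelativeEntropy

open InformationTheory Real

variable {Ω : Type*} [MeasurableSpace Ω]

/-- Young's inequality for the convex function `klFun` and its conjugate `exp - 1`. -/
lemma mul_le_klFun_add_exp_sub_one {g : ℝ} (hg : 0 ≤ g) (t : ℝ) :
    g * t ≤ klFun g + (exp t - 1) := by
  rcases hg.eq_or_lt with rfl | hg
  · simp [klFun_zero, (exp_pos t).le]
  · have h1 := add_one_le_exp (t - log g)
    have h2 : g * exp (t - log g) = exp t := by
      rw [exp_sub, exp_log hg]; field_simp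
    have h3 := mul_le_mul_of_nonneg_left h1 hg.le
    rw [klFun_apply]
    nlinarith

lemma integrable_klFun_rnDeriv {ν ρ : Measure Ω} [IsProbabilityMeasure ν] [IsProbabilityMeasure ρ]
    (hkl : klDiv ν ρ ≠ ∞) : Integrable (fun x => klFun (ν.rnDeriv ρ x).toReal) ρ :=
  have h := klDiv_ne_top_iff.1 hkl
  (integrable_klFun_rnDeriv_iff h.1).2 h.2

/-- The Gibbs variational inequality, localized to a set `A` that carries `ν`. -/
lemma integral_le_toReal_klDiv_add_log {ν ρ : Measure Ω} [IsProbabilityMeasure ν]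
    [IsProbabilityMeasure ρ] (hkl : klDiv ν ρ ≠ ∞) {A : Set Ω} (hA : MeasurableSet A)
    (hνA : ν Aᶜ = 0) {y : Ω → ℝ} (hy : Integrable y ν)
    (he : IntegrableOn (fun x => exp (y x)) A ρ) :
    ∫ x, y x ∂ν ≤ (klDiv ν ρ).toReal + log (∫ x in A, exp (y x) ∂ρ) := by
  obtain ⟨hac, -⟩ := klDiv_ne_top_iff.1 hkl
  set Z := ∫ x in A, exp (y x) ∂ρ with hZ
  have hρA : ρ A ≠ 0 := by
    intro h0
    have h1 : ν univ ≤ ν A + ν Aᶜ := by rw [← union_compl_self A]; exact measure_union_le _ _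
    rw [hac h0, hνA] at h1
    simp at h1
  have : NeZero (ρ.restrict A) := ⟨by simpa [Measure.restrict_eq_zero] using hρA⟩
  have hZpos : 0 < Z := integral_exp_pos he
  have hgA : ∀ᵐ x ∂ρ, x ∈ Aᶜ → ν.rnDeriv ρ x = 0 := by
    rw [← ae_restrict_iff' hA.compl]
    have h2 := Measure.setLIntegral_rnDeriv hac Aᶜ
    rw [hνA, lintegral_eq_zero_iff (Measure.measurable_rnDeriv _ _)] at h2
    exact h2
  have hyi : Integrable (fun x => (ν.rnDeriv ρ x).toReal • y x) ρ :=
    (integrable_rnDeriv_smul_iff hac).2 hy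
  have hgi : Integrable (fun x => (ν.rnDeriv ρ x).toReal) ρ := Measure.integrable_toReal_rnDeriv
  have hind : Integrable (fun x => A.indicator (fun x => exp (y x)) x * Z⁻¹) ρ :=
    ((integrable_indicator_iff hA).2 he).mul_const _
  have hei : Integrable (fun x => A.indicator (fun x => exp (y x)) x * Z⁻¹ - 1) ρ :=
    hind.sub (integrable_const _)
  -- Young's inequality with `g = dν/dρ` and `t = y - log Z`; outside `A` both sides vanish.
  have hmain : ∫ x, (ν.rnDeriv ρ x).toReal • y x - log Z * (ν.rnDeriv ρ x).toReal ∂ρ ≤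
      ∫ x, klFun (ν.rnDeriv ρ x).toReal + (A.indicator (fun x => exp (y x)) x * Z⁻¹ - 1) ∂ρ := by
    refine integral_mono_ae (hyi.sub (hgi.const_mul _)) ((integrable_klFun_rnDeriv hkl).add hei) ?_
    filter_upwards [hgA] with x hx
    by_cases hxA : x ∈ A
    · have := mul_le_klFun_add_exp_sub_one (g := (ν.rnDeriv ρ x).toReal)
        ENNReal.toReal_nonneg (y x - log Z)
      rw [exp_sub, exp_log hZpos, div_eq_mul_inv] at this
      simp only [smul_eq_mul, indicator_of_mem hxA]
      linarith
    · simp [hx hxA, hxA, klFun_zero]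
  rw [integral_sub hyi (hgi.const_mul _), integral_rnDeriv_smul hac, integral_const_mul,
    Measure.integral_toReal_rnDeriv hac, integral_add (integrable_klFun_rnDeriv hkl) hei,
    ← toReal_klDiv_eq_integral_klFun hac, integral_sub hind (integrable_const _),
    integral_mul_const, integral_indicator hA, ← hZ, mul_inv_cancel₀ hZpos.ne'] at hmain
  simp only [probReal_univ, integral_const, smul_eq_mul] at hmain
  linarith

/-- A function with two-sided exponential moments under `ρ` is integrable under every measure of
finite relative entropy with respect to `ρ`. -/
lemma integrable_of_klDiv_ne_top {ν ρ : Measure Ω} [IsProbabilityMeasure ν]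
    [IsProbabilityMeasure ρ] (hkl : klDiv ν ρ ≠ ∞) {h : Ω → ℝ} (hm : AEStronglyMeasurable h ρ)
    {ε : ℝ} (hε : 0 < ε) (h₁ : Integrable (fun x => exp (ε * h x)) ρ)
    (h₂ : Integrable (fun x => exp (-ε * h x)) ρ) : Integrable h ν := by
  obtain ⟨hac, -⟩ := klDiv_ne_top_iff.1 hkl
  rw [← integrable_rnDeriv_smul_iff hac]
  refine Integrable.mono' (g := fun x => ε⁻¹ * (klFun (ν.rnDeriv ρ x).toReal +
    (exp (ε * h x) + exp (-ε * h x)))) (((integrable_klFun_rnDeriv hkl).add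
      (h₁.add h₂)).const_mul _) ?_ (Eventually.of_forall fun x => ?_)
  · exact (Measure.measurable_rnDeriv _ _).ennreal_toReal.aestronglyMeasurable.smul hm
  · have h3 := mul_le_klFun_add_exp_sub_one (g := (ν.rnDeriv ρ x).toReal)
      ENNReal.toReal_nonneg (ε * |h x|)
    have h4 : exp (ε * |h x|) ≤ exp (ε * h x) + exp (-ε * h x) := by
      rcases abs_cases (h x) with ⟨h', -⟩ | ⟨h', -⟩ <;> rw [h']
      · linarith [exp_pos (-ε * h x)]
      · rw [mul_neg, ← neg_mul]; linarith [exp_pos (ε * h x)]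
    simp only [norm_smul, Real.norm_eq_abs, abs_of_nonneg ENNReal.toReal_nonneg]
    rw [inv_mul_eq_div, le_div_iff₀ hε]
    linarith

lemma klDiv_withDensity_ofReal {ρ : Measure Ω} [IsProbabilityMeasure ρ] {f : Ω → ℝ}
    (hf : AEMeasurable f ρ) (hf0 : ∀ x, 0 ≤ f x)
    [IsFiniteMeasure (ρ.withDensity fun x => ENNReal.ofReal (f x))] :
    klDiv (ρ.withDensity fun x => ENNReal.ofReal (f x)) ρ =
      ∫⁻ x, ENNReal.ofReal (klFun (f x)) ∂ρ := by
  rw [klDiv_eq_lintegral_klFun_of_ac (withDensity_absolutelyContinuous _ _)]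
  refine lintegral_congr_ae ?_
  filter_upwards [Measure.rnDeriv_withDensity₀ ρ hf.ennreal_ofReal] with x hx
  rw [hx, ENNReal.toReal_ofReal (hf0 x)]

/-- The Gibbs measure `e^y 1_A ρ / Z` attains equality in the Gibbs variational inequality. -/
lemma exists_gibbs_measure {ρ : Measure Ω} [IsProbabilityMeasure ρ] {A : Set Ω}
    (hA : MeasurableSet A) {y : Ω → ℝ} (he : IntegrableOn (fun x => exp (y x)) A ρ)
    (hye : IntegrableOn (fun x => y x * exp (y x)) A ρ)
    (hZ : 0 < ∫ x in A, exp (y x) ∂ρ) :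
    ∃ ν : Measure Ω, ν = ρ.withDensity (fun x => ENNReal.ofReal
        (A.indicator (fun x => exp (y x)) x / ∫ x in A, exp (y x) ∂ρ)) ∧
      IsProbabilityMeasure ν ∧ ν Aᶜ = 0 ∧ klDiv ν ρ ≠ ∞ ∧
      (klDiv ν ρ).toReal ≤ ∫ x, y x ∂ν - log (∫ x in A, exp (y x) ∂ρ) := by
  set Z := ∫ x in A, exp (y x) ∂ρ with hZdef
  set f : Ω → ℝ := fun x => A.indicator (fun x => exp (y x)) x / Z with hf
  have hf0 : ∀ x, 0 ≤ f x := fun x =>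
    div_nonneg (indicator_nonneg (fun _ _ => (exp_pos _).le) _) hZ.le
  have hfi : Integrable f ρ := ((integrable_indicator_iff hA).2 he).div_const _
  have hfm : AEMeasurable f ρ := hfi.aemeasurable
  have hf1 : ∫ x, f x ∂ρ = 1 := by
    simp only [hf]
    rw [integral_div, integral_indicator hA, ← hZdef, div_self hZ.ne']
  have hfy : Integrable (fun x => f x * y x) ρ := by
    refine (((integrable_indicator_iff hA).2 hye).div_const Z).congr
      (Eventually.of_forall fun x => ?_)
    by_cases hx : x ∈ A <;> simp [hf, hx]
    ring
  have hprob : IsProbabilityMeasure (ρ.withDensity fun x => ENNReal.ofReal (f x)) := by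
    refine ⟨?_⟩
    rw [withDensity_apply _ MeasurableSet.univ, setLIntegral_univ,
      ← ofReal_integral_eq_lintegral_ofReal hfi (Eventually.of_forall hf0), hf1, ENNReal.ofReal_one]
  refine ⟨_, rfl, hprob, ?_, ?_⟩
  · rw [withDensity_apply _ hA.compl, ← nonpos_iff_eq_zero]
    refine (setLIntegral_mono' hA.compl (g := 0) fun x hx => ?_).trans (by simp)
    simp [indicator_of_notMem (hx : x ∉ A)]
  · have hk : ∀ x, klFun (f x) = f x * y x - log Z * f x + (1 - f x) := by
      intro x
      by_cases hx : x ∈ A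
      · simp only [hf, indicator_of_mem hx, klFun_apply]
        rw [log_div (exp_pos _).ne' hZ.ne', log_exp]; ring
      · simp [hf, hx, klFun_zero]
    have hi₁ : Integrable (fun x => f x * y x - log Z * f x) ρ := hfy.sub (hfi.const_mul _)
    have hi₂ : Integrable (fun x => 1 - f x) ρ := (integrable_const _).sub hfi
    have hki : Integrable (fun x => klFun (f x)) ρ := by
      simp_rw [hk]
      exact hi₁.add hi₂
    have hint : ∫ x, y x ∂(ρ.withDensity fun x => ENNReal.ofReal (f x)) = ∫ x, f x * y x ∂ρ := by
      rw [integral_withDensity_eq_integral_toReal_smul₀ hfm.ennreal_ofReal (by simp)]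
      simp [ENNReal.toReal_ofReal (hf0 _)]
    rw [klDiv_withDensity_ofReal hfm hf0, ← ofReal_integral_eq_lintegral_ofReal hki
      (Eventually.of_forall fun x => klFun_nonneg (hf0 x))]
    refine ⟨ENNReal.ofReal_ne_top, ?_⟩
    rw [ENNReal.toReal_ofReal (integral_nonneg fun x => klFun_nonneg (hf0 x)), hint]
    simp_rw [hk]
    rw [integral_add hi₁ hi₂,
      integral_sub hfy (hfi.const_mul _), integral_sub (integrable_const _) hfi,
      integral_const_mul, hf1]
    simp

open ProbabilityTheory in
lemma cond_eq_withDensity {ν ρ : Measure Ω} [IsProbabilityMeasure ν] [IsProbabilityMeasure ρ]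
    (hac : ν ≪ ρ) {A : Set Ω} (hA : MeasurableSet A) (hp : 0 < ν.real A) :
    cond ν A = ρ.withDensity (fun x => ENNReal.ofReal
      (A.indicator (fun x => (ν.rnDeriv ρ x).toReal) x / ν.real A)) := by
  ext B hB
  rw [cond_apply hA, withDensity_apply _ hB, ← Measure.setLIntegral_rnDeriv hac (A ∩ B),
    ← lintegral_const_mul _ (Measure.measurable_rnDeriv _ _),
    ← setLIntegral_indicator hA]
  refine setLIntegral_congr_fun_ae hB ?_
  filter_upwards [Measure.rnDeriv_ne_top ν ρ] with x hx _
  by_cases hxA : x ∈ A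
  · rw [indicator_of_mem hxA, indicator_of_mem hxA, ENNReal.ofReal_div_of_pos hp,
      ENNReal.ofReal_toReal hx, measureReal_def, ENNReal.ofReal_toReal (by simp),
      ENNReal.div_eq_inv_mul]
  · simp [hxA]

open ProbabilityTheory in
/-- Conditioning on an event of probability `p` increases the relative entropy at most by the
factor `p⁻¹` and the additive constant `1 - log p`. -/
lemma klDiv_cond_le {ν ρ : Measure Ω} [IsProbabilityMeasure ν] [IsProbabilityMeasure ρ]
    (hkl : klDiv ν ρ ≠ ∞) {A : Set Ω} (hA : MeasurableSet A) (hp : 0 < ν.real A) :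
    klDiv (cond ν A) ρ ≠ ∞ ∧
      (klDiv (cond ν A) ρ).toReal ≤ (klDiv ν ρ).toReal / ν.real A - log (ν.real A) + 1 := by
  obtain ⟨hac, -⟩ := klDiv_ne_top_iff.1 hkl
  set p := ν.real A with hpdef
  have hp1 : p ≤ 1 := measureReal_le_one
  set g : Ω → ℝ := fun x => (ν.rnDeriv ρ x).toReal with hg
  have hg0 : ∀ x, 0 ≤ g x := fun x => ENNReal.toReal_nonneg
  have hgi : Integrable g ρ := Measure.integrable_toReal_rnDeriv
  set f : Ω → ℝ := fun x => A.indicator g x / p with hf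
  have hf0 : ∀ x, 0 ≤ f x := fun x => div_nonneg (indicator_nonneg (fun _ _ => hg0 _) _) hp.le
  have hgA : ∫ x in A, g x ∂ρ = p := Measure.setIntegral_toReal_rnDeriv hac A
  have hν : cond ν A = ρ.withDensity fun x => ENNReal.ofReal (f x) := cond_eq_withDensity hac hA hp
  have hfi : Integrable f ρ := ((hgi.indicator hA)).div_const _
  have hprob : IsProbabilityMeasure (cond ν A) :=
    cond_isProbabilityMeasure (by
      rw [hpdef, measureReal_def] at hp; exact (ENNReal.toReal_pos_iff.1 hp).1.ne')
  have hfin : IsFiniteMeasure (ρ.withDensity fun x => ENNReal.ofReal (f x)) := hν ▸ inferInstance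
  have hb : ∀ x, klFun (f x) ≤ klFun (g x) / p + (-log p) * f x + 1 := by
    intro x
    have hlp : 0 ≤ -log p := neg_nonneg.2 (log_nonpos hp.le hp1)
    have hk := klFun_nonneg (hg0 x)
    by_cases hx : x ∈ A
    · have hfx : f x = g x / p := by simp [hf, hx]
      rw [hfx, klFun_apply, klFun_apply]
      have h1p : 1 ≤ 1 / p := (one_le_div hp).2 hp1
      rcases (hg0 x).eq_or_lt with h0 | h0
      · rw [← h0]; simp; linarith [h1p, one_div p ▸ h1p]
      · rw [log_div h0.ne' hp.ne']
        have : g x / p * (log (g x) - log p) + 1 - g x / p = (g x * log (g x) + 1 - g x) / p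
            + -log p * (g x / p) + 1 - 1 / p := by field_simp; ring
        rw [this]; linarith
    · have hfx : f x = 0 := by simp [hf, hx]
      rw [hfx, klFun_zero]
      have : 0 ≤ klFun (g x) / p := div_nonneg hk hp.le
      simpa using this
  have hgk := integrable_klFun_rnDeriv hkl
  have hi₁ : Integrable (fun x => klFun (g x) / p + (-log p) * f x) ρ :=
    (hgk.div_const _).add (hfi.const_mul _)
  have hbi : Integrable (fun x => klFun (g x) / p + (-log p) * f x + 1) ρ :=
    hi₁.add (integrable_const _)
  have hle : klDiv (cond ν A) ρ ≤
      ENNReal.ofReal ((klDiv ν ρ).toReal / p - log p + 1) := by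
    rw [hν, klDiv_withDensity_ofReal hfi.aemeasurable hf0]
    refine (lintegral_mono fun x => ENNReal.ofReal_le_ofReal (hb x)).trans ?_
    rw [← ofReal_integral_eq_lintegral_ofReal hbi
      (Eventually.of_forall fun x => (klFun_nonneg (hf0 x)).trans (hb x))]
    refine ENNReal.ofReal_le_ofReal (le_of_eq ?_)
    rw [integral_add hi₁ (integrable_const _),
      integral_add (hgk.div_const _) (hfi.const_mul _), integral_div, integral_const_mul,
      toReal_klDiv_eq_integral_klFun hac]
    have : ∫ x, f x ∂ρ = 1 := by
      simp only [hf]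
      rw [integral_div, integral_indicator hA, hgA, div_self hp.ne']
    rw [this]
    simp; ring
  refine ⟨ne_top_of_le_ne_top ENNReal.ofReal_ne_top hle, ?_⟩
  refine ENNReal.toReal_le_of_le_ofReal ?_ hle
  have : 0 ≤ (klDiv ν ρ).toReal / p := div_nonneg ENNReal.toReal_nonneg hp.le
  linarith [log_nonpos hp.le hp1]

variable {Ω' : Type*} [MeasurableSpace Ω']

lemma klDiv_map_measurableEquiv (e : Ω ≃ᵐ Ω') (μ ν : Measure Ω) [IsFiniteMeasure μ]
    [IsFiniteMeasure ν] : klDiv (μ.map e) (ν.map e) = klDiv μ ν := by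
  refine le_antisymm (klDiv_map_le _ _ e.measurable) ?_
  have h := klDiv_map_le (μ.map e) (ν.map e) e.symm.measurable
  simpa [Measure.map_map e.symm.measurable e.measurable] using h

lemma klDiv_prod (μ μ' : Measure Ω) (ν ν' : Measure Ω') [IsProbabilityMeasure μ]
    [IsProbabilityMeasure μ'] [IsProbabilityMeasure ν] [IsProbabilityMeasure ν'] :
    klDiv (μ.prod ν) (μ'.prod ν') = klDiv μ μ' + klDiv ν ν' := by
  have h := klDiv_compProd_eq_add μ μ' (ProbabilityTheory.Kernel.const Ω ν)
    (ProbabilityTheory.Kernel.const Ω ν')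
  simp only [Measure.compProd_const] at h
  rw [h]
  congr 1
  rw [← klDiv_map_measurableEquiv MeasurableEquiv.prodComm]
  have h2 := klDiv_compProd_left ν ν' (ProbabilityTheory.Kernel.const Ω' μ)
  simp only [Measure.compProd_const] at h2
  rw [← h2]
  congr 1 <;> exact Measure.prod_swap

/-- Additivity of the relative entropy over product measures. -/
lemma klDiv_pi_const (μ ν : Measure Ω) [IsProbabilityMeasure μ] [IsProbabilityMeasure ν] (n : ℕ) :
    klDiv (Measure.pi fun _ : Fin n => μ) (Measure.pi fun _ : Fin n => ν) = n * klDiv μ ν := by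
  induction n with
  | zero =>
    have h : (Measure.pi fun _ : Fin 0 => μ) = Measure.pi fun _ : Fin 0 => ν := by
      rw [Measure.pi_of_empty, Measure.pi_of_empty]
    simp [h]
  | succ n ih =>
    have e₁ := measurePreserving_piFinSuccAbove (fun _ : Fin (n + 1) => μ) 0
    have e₂ := measurePreserving_piFinSuccAbove (fun _ : Fin (n + 1) => ν) 0
    rw [← klDiv_map_measurableEquiv (MeasurableEquiv.piFinSuccAbove (fun _ => Ω) 0), e₁.map_eq,
      e₂.map_eq, klDiv_prod, ih]
    push_cast
    ring

end RelativeEntropy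

/-! ### The dual formula for the relative entropy -/

section DualFormula

open InformationTheory Real

variable {X : Type*} [TopologicalSpace X] [CompactSpace X] [TopologicalSpace.MetrizableSpace X]
  [MeasurableSpace X] [BorelSpace X]

/-- The affine functional `μ ↦ ∫ f dμ - ∫ (e^f - 1) dμ₀`. The supremum of these functionals over
continuous `f` is the relative entropy of `μ` with respect to `μ₀`. -/
noncomputable def dualFunctional (μ₀ : ProbabilityMeasure X) (f : C(X, ℝ))
    (μ : ProbabilityMeasure X) : ℝ :=
  ∫ x, f x ∂(μ : Measure X) - ∫ x, (exp (f x) - 1) ∂(μ₀ : Measure X)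

lemma integrable_continuousMap (f : C(X, ℝ)) (μ : Measure X) [IsFiniteMeasure μ] :
    Integrable f μ :=
  f.continuous.integrable_of_hasCompactSupport (HasCompactSupport.of_compactSpace _)

lemma continuous_integral_probabilityMeasure {Y : Type*} [TopologicalSpace Y] [CompactSpace Y]
    [MeasurableSpace Y] [OpensMeasurableSpace Y] (f : C(Y, ℝ)) :
    Continuous fun μ : ProbabilityMeasure Y => ∫ x, f x ∂(μ : Measure Y) := by
  rw [continuous_iff_continuousAt]
  intro μ
  exact (ProbabilityMeasure.tendsto_iff_forall_integral_tendsto.1 tendsto_id)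
    (BoundedContinuousFunction.mkOfCompact f)

lemma continuous_dualFunctional (μ₀ : ProbabilityMeasure X) (f : C(X, ℝ)) :
    Continuous (dualFunctional μ₀ f) :=
  (continuous_integral_probabilityMeasure f).sub continuous_const

lemma continuous_integral_continuousMap (μ : Measure X) [IsProbabilityMeasure μ] :
    Continuous fun f : C(X, ℝ) => ∫ x, f x ∂μ := by
  refine (LipschitzWith.of_dist_le_mul (K := 1) fun f g => ?_).continuous
  rw [Real.dist_eq, ← integral_sub (integrable_continuousMap f μ) (integrable_continuousMap g μ)]
  have h := norm_integral_le_of_norm_le_const (μ := μ) (f := fun x => f x - g x) (C := dist f g)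
    (Eventually.of_forall fun x => by
      rw [Real.norm_eq_abs, ← Real.dist_eq]; exact ContinuousMap.dist_apply_le_dist x)
  simpa using h

lemma continuous_dualFunctional_left (μ₀ μ : ProbabilityMeasure X) :
    Continuous fun f : C(X, ℝ) => dualFunctional μ₀ f μ := by
  refine (continuous_integral_continuousMap _).sub ?_
  let e : C(ℝ, ℝ) := ⟨fun t => exp t - 1, by fun_prop⟩
  exact (continuous_integral_continuousMap (μ₀ : Measure X)).comp
    (ContinuousMap.continuous_postcomp e)

lemma abs_exp_sub_exp_le {M s t : ℝ} (hs : s ≤ M) (ht : t ≤ M) :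
    |exp s - exp t| ≤ exp M * |s - t| := by
  wlog hst : t ≤ s generalizing s t
  · rw [abs_sub_comm, abs_sub_comm s t]; exact this ht hs (le_of_not_ge hst)
  rw [abs_of_nonneg (sub_nonneg.2 (exp_le_exp.2 hst)), abs_of_nonneg (sub_nonneg.2 hst)]
  have h1 := add_one_le_exp (t - s)
  have h2 : exp t = exp s * exp (t - s) := by rw [← exp_add]; ring_nf
  have h3 : exp s ≤ exp M := exp_le_exp.2 hs
  have h4 : exp s - exp t ≤ exp s * (s - t) := by
    rw [h2]; nlinarith [exp_pos s]
  exact h4.trans (mul_le_mul_of_nonneg_right h3 (sub_nonneg.2 hst))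

/-- Bounded measurable test functions do not increase the supremum in the dual formula, by density
of the continuous functions in `L¹(μ + μ₀)`. -/
lemma integral_sub_le_of_forall_dualFunctional_le {μ₀ μ : ProbabilityMeasure X} {S : ℝ}
    (hS : ∀ f : C(X, ℝ), dualFunctional μ₀ f μ ≤ S) {u : X → ℝ} (hu : Measurable u) {M : ℝ}
    (hM : ∀ x, |u x| ≤ M) :
    ∫ x, u x ∂(μ : Measure X) - ∫ x, (exp (u x) - 1) ∂(μ₀ : Measure X) ≤ S := by
  have hexp : ∀ {v : X → ℝ}, Measurable v → (∀ x, |v x| ≤ M) →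
      Integrable (fun x => exp (v x) - 1) (μ₀ : Measure X) := by
    intro v hv hvM
    refine Integrable.sub (Integrable.of_bound (C := exp M) hv.exp.aestronglyMeasurable
      (Eventually.of_forall fun x => ?_)) (integrable_const _)
    rw [Real.norm_eq_abs, abs_exp]
    exact exp_le_exp.2 ((le_abs_self _).trans (hvM x))
  have hint : ∀ (ν : Measure X) [IsFiniteMeasure ν], Integrable u ν := fun ν _ =>
    Integrable.of_bound (C := M) hu.aestronglyMeasurable (Eventually.of_forall hM)
  have key : ∀ ε : ℝ, 0 < ε → ∫ x, u x ∂(μ : Measure X) - ∫ x, (exp (u x) - 1) ∂(μ₀ : Measure X)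
      ≤ S + (1 + exp M) * ε := by
    intro ε hε
    obtain ⟨g, hg, -⟩ := (hint ((μ : Measure X) +
      (μ₀ : Measure X))).exists_boundedContinuous_integral_sub_le hε
    -- Clamping keeps the approximation and makes the exponentials comparable.
    let f : C(X, ℝ) := ⟨fun x => max (-M) (min (g x) M), by fun_prop⟩
    have hfM : ∀ x, |f x| ≤ M := fun x => by
      have hM0 : 0 ≤ M := (abs_nonneg _).trans (hM x)
      exact abs_le.2 ⟨le_max_left _ _, max_le (by linarith) (min_le_right _ _)⟩
    have hfu : ∀ x, |u x - f x| ≤ |u x - g x| := fun x => by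
      have hux := abs_le.1 (hM x)
      show |u x - max (-M) (min (g x) M)| ≤ |u x - g x|
      have h1 : u x = max (-M) (min (u x) M) := by
        rw [min_eq_left hux.2, max_eq_right hux.1]
      calc |u x - max (-M) (min (g x) M)|
          = |max (-M) (min (u x) M) - max (-M) (min (g x) M)| := by rw [← h1]
        _ ≤ |min (u x) M - min (g x) M| := by
          simpa [max_comm] using abs_max_sub_max_le_abs (min (u x) M) (min (g x) M) (-M)
        _ ≤ |u x - g x| := abs_inf_sub_inf_le_abs _ _ _
    have hgi : Integrable (fun x => |u x - g x|) ((μ : Measure X) + (μ₀ : Measure X)) :=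
      ((hint _).sub (g.integrable _)).abs
    simp only [Real.norm_eq_abs] at hg
    rw [integral_add_measure hgi.left_of_add_measure hgi.right_of_add_measure] at hg
    have hp : 0 ≤ ∫ x, |u x - g x| ∂(μ : Measure X) := integral_nonneg fun _ => abs_nonneg _
    have hp₀ : 0 ≤ ∫ x, |u x - g x| ∂(μ₀ : Measure X) := integral_nonneg fun _ => abs_nonneg _
    have e1 : ∫ x, u x ∂(μ : Measure X) - ∫ x, f x ∂(μ : Measure X) ≤
        ∫ x, |u x - g x| ∂(μ : Measure X) := by
      rw [← integral_sub (hint _) (integrable_continuousMap f _)]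
      exact integral_mono ((hint _).sub (integrable_continuousMap f _)) hgi.left_of_add_measure
        fun x => (le_abs_self _).trans (hfu x)
    have e2 : ∫ x, (exp (f x) - 1) ∂(μ₀ : Measure X) - ∫ x, (exp (u x) - 1) ∂(μ₀ : Measure X) ≤
        exp M * ∫ x, |u x - g x| ∂(μ₀ : Measure X) := by
      have hfe := hexp f.continuous.measurable hfM
      rw [← integral_sub hfe (hexp hu hM), ← integral_const_mul]
      refine integral_mono (hfe.sub (hexp hu hM)) (hgi.right_of_add_measure.const_mul _)
        fun x => ?_
      have h1 := abs_exp_sub_exp_le (M := M) ((le_abs_self _).trans (hfM x))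
        ((le_abs_self _).trans (hM x))
      have h2 := mul_le_mul_of_nonneg_left (hfu x) (exp_pos M).le
      have h3 := le_abs_self (exp (f x) - exp (u x))
      rw [abs_sub_comm (f x)] at h1
      show exp (f x) - 1 - (exp (u x) - 1) ≤ exp M * |u x - g x|
      linarith
    have e3 := hS f
    unfold dualFunctional at e3
    nlinarith [exp_pos M]
  refine le_of_forall_pos_le_add fun δ hδ => ?_
  have h1 : 0 < 1 + exp M := by positivity
  have := key (δ / (1 + exp M)) (by positivity)
  rwa [mul_div_cancel₀ _ h1.ne'] at this

/-- Testing with `t 1_A` for a `μ₀`-null set `A` and large `t` forces `μ A = 0`. -/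
lemma absolutelyContinuous_of_forall_dualFunctional_le {μ₀ μ : ProbabilityMeasure X} {S : ℝ}
    (hS : ∀ f : C(X, ℝ), dualFunctional μ₀ f μ ≤ S) : (μ : Measure X) ≪ (μ₀ : Measure X) := by
  refine Measure.AbsolutelyContinuous.mk fun A hA hA0 => ?_
  by_contra hne
  have hpos : 0 < (μ : Measure X).real A :=
    ENNReal.toReal_pos hne (measure_ne_top _ _)
  have key : ∀ t : ℝ, t * (μ : Measure X).real A ≤ S := by
    intro t
    have h := integral_sub_le_of_forall_dualFunctional_le hS (u := A.indicator fun _ => t)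
      (measurable_const.indicator hA) (M := |t|) (fun x => by
        by_cases hx : x ∈ A <;> simp [hx])
    have h0 : ∫ x, (exp (A.indicator (fun _ => t) x) - 1) ∂(μ₀ : Measure X) = 0 := by
      refine integral_eq_zero_of_ae ?_
      have : ∀ᵐ x ∂(μ₀ : Measure X), x ∉ A := measure_eq_zero_iff_ae_notMem.1 hA0
      filter_upwards [this] with x hx
      simp [hx]
    rw [h0, integral_indicator_const _ hA, smul_eq_mul] at h
    linarith
  have h1 := key ((S + 1) / (μ : Measure X).real A)
  rw [div_mul_cancel₀ _ hpos.ne'] at h1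
  linarith

/-- Clamping of a density to the interval `[(n + 1)⁻¹, n + 1]`. -/
noncomputable def clampDensity (n : ℕ) (g : ℝ) : ℝ := max ((n : ℝ) + 1)⁻¹ (min g ((n : ℝ) + 1))

lemma measurable_clampDensity (n : ℕ) : Measurable (clampDensity n) := by
  unfold clampDensity; fun_prop

lemma clampDensity_pos (n : ℕ) (g : ℝ) : 0 < clampDensity n g :=
  lt_max_of_lt_left (by positivity)

lemma inv_natCast_add_one_le (n : ℕ) : ((n : ℝ) + 1)⁻¹ ≤ 1 :=
  inv_le_one_of_one_le₀ (by linarith [n.cast_nonneg (α := ℝ)])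

lemma abs_log_clampDensity_le (n : ℕ) (g : ℝ) : |log (clampDensity n g)| ≤ log (n + 1) := by
  have hn : (0 : ℝ) < n + 1 := by positivity
  have h1 : ((n : ℝ) + 1)⁻¹ ≤ clampDensity n g := le_max_left _ _
  have h2 : clampDensity n g ≤ n + 1 :=
    max_le ((inv_natCast_add_one_le n).trans (by linarith [n.cast_nonneg (α := ℝ)]))
      (min_le_right _ _)
  rw [abs_le, ← log_inv]
  exact ⟨log_le_log (by positivity) h1, log_le_log (clampDensity_pos n g) h2⟩

lemma mul_log_clampDensity_nonneg (n : ℕ) (g : ℝ) :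
    0 ≤ g * log (clampDensity n g) - (clampDensity n g - 1) := by
  have hn : (0 : ℝ) ≤ n := n.cast_nonneg
  have hk := klFun_nonneg (clampDensity_pos n g).le
  rw [klFun_apply] at hk
  have h : 0 ≤ (g - clampDensity n g) * log (clampDensity n g) := by
    rcases le_total ((n : ℝ) + 1) g with hg | hg
    · have : clampDensity n g = n + 1 := by
        unfold clampDensity
        rw [min_eq_right hg, max_eq_right ((inv_natCast_add_one_le n).trans (by linarith))]
      rw [this]
      exact mul_nonneg (by linarith) (log_nonneg (by linarith))
    · rcases le_total g ((n : ℝ) + 1)⁻¹ with hg' | hg'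
      · have : clampDensity n g = ((n : ℝ) + 1)⁻¹ := by
          unfold clampDensity
          rw [min_eq_left hg, max_eq_left hg']
        rw [this]
        exact mul_nonneg_of_nonpos_of_nonpos (by linarith)
          (log_nonpos (by positivity) (inv_natCast_add_one_le n))
      · have : clampDensity n g = g := by
          unfold clampDensity
          rw [min_eq_left hg, max_eq_right hg']
        rw [this]; simp
  linarith

lemma tendsto_mul_log_clampDensity {g : ℝ} (hg : 0 ≤ g) :
    Tendsto (fun n : ℕ => g * log (clampDensity n g) - (clampDensity n g - 1)) atTop
      (𝓝 (klFun g)) := by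
  have hinv : Tendsto (fun n : ℕ => ((n : ℝ) + 1)⁻¹) atTop (𝓝 0) :=
    (tendsto_natCast_atTop_atTop.atTop_add tendsto_const_nhds).inv_tendsto_atTop
  rcases hg.eq_or_lt with rfl | hg
  · have h : ∀ n : ℕ, clampDensity n 0 = ((n : ℝ) + 1)⁻¹ := fun n => by
      unfold clampDensity
      rw [min_eq_left (by positivity), max_eq_left (by positivity)]
    simp only [h, zero_mul, klFun_zero]
    simpa using (hinv.sub_const 1).const_sub 0
  · refine tendsto_const_nhds.congr' ?_
    have h1 : ∀ᶠ n : ℕ in atTop, ((n : ℝ) + 1)⁻¹ < g := hinv.eventually_lt_const hg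
    have h2 : ∀ᶠ n : ℕ in atTop, g ≤ n :=
      tendsto_natCast_atTop_atTop.eventually_ge_atTop g
    filter_upwards [h1, h2] with n hn hn'
    have : clampDensity n g = g := by
      unfold clampDensity
      rw [min_eq_left (by linarith), max_eq_right hn.le]
    rw [this, klFun_apply]; ring

/-- The hard half of the dual formula: test with the logarithm of the clamped density and apply
Fatou's lemma, the integrands being nonnegative. -/
lemma klDiv_le_of_forall_dualFunctional_le {μ₀ μ : ProbabilityMeasure X} {S : ℝ}
    (hS : ∀ f : C(X, ℝ), dualFunctional μ₀ f μ ≤ S) :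
    klDiv (μ : Measure X) (μ₀ : Measure X) ≤ ENNReal.ofReal S := by
  have hac := absolutelyContinuous_of_forall_dualFunctional_le hS
  set g : X → ℝ := fun x => ((μ : Measure X).rnDeriv μ₀ x).toReal with hg
  have hgm : Measurable g := (Measure.measurable_rnDeriv _ _).ennreal_toReal
  have hg0 : ∀ x, 0 ≤ g x := fun x => ENNReal.toReal_nonneg
  have hm : ∀ n, Measurable fun x => log (clampDensity n (g x)) := fun n =>
    measurable_log.comp ((measurable_clampDensity n).comp hgm)
  rw [klDiv_eq_lintegral_klFun_of_ac hac]
  calc ∫⁻ x, ENNReal.ofReal (klFun (g x)) ∂(μ₀ : Measure X)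
      = ∫⁻ x, liminf (fun n => ENNReal.ofReal
          (g x * log (clampDensity n (g x)) - (clampDensity n (g x) - 1))) atTop
          ∂(μ₀ : Measure X) := by
        refine lintegral_congr fun x => ?_
        exact ((ENNReal.continuous_ofReal.tendsto _).comp
          (tendsto_mul_log_clampDensity (hg0 x))).liminf_eq.symm
    _ ≤ liminf (fun n => ∫⁻ x, ENNReal.ofReal
          (g x * log (clampDensity n (g x)) - (clampDensity n (g x) - 1)) ∂(μ₀ : Measure X))
          atTop :=
        lintegral_liminf_le fun n => ((hgm.mul (hm n)).sub
          (((measurable_clampDensity n).comp hgm).sub_const 1)).ennreal_ofReal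
    _ ≤ ENNReal.ofReal S := by
        refine liminf_le_of_le (by isBoundedDefault) fun b hb => ?_
        obtain ⟨n, hn⟩ := hb.exists
        refine hn.trans ?_
        have hui : Integrable (fun x => log (clampDensity n (g x))) (μ : Measure X) :=
          Integrable.of_bound (C := log (n + 1)) (hm n).aestronglyMeasurable
            (Eventually.of_forall fun x => abs_log_clampDensity_le n (g x))
        have hi1 : Integrable (fun x => g x * log (clampDensity n (g x))) (μ₀ : Measure X) :=
          (integrable_rnDeriv_smul_iff hac).2 hui
        have hi2 : Integrable (fun x => clampDensity n (g x) - 1) (μ₀ : Measure X) := by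
          refine Integrable.sub (Integrable.of_bound (C := n + 1)
            ((measurable_clampDensity n).comp hgm).aestronglyMeasurable
            (Eventually.of_forall fun x => ?_)) (integrable_const _)
          have h1 := clampDensity_pos n (g x)
          have h2 := (le_abs_self _).trans (abs_log_clampDensity_le n (g x))
          rw [Real.norm_eq_abs, abs_of_pos h1]
          exact (log_le_log_iff h1 (by positivity)).1 h2
        have hi : Integrable (fun x => g x * log (clampDensity n (g x)) -
            (clampDensity n (g x) - 1)) (μ₀ : Measure X) := hi1.sub hi2
        rw [← ofReal_integral_eq_lintegral_ofReal hi
          (Eventually.of_forall fun x => mul_log_clampDensity_nonneg n (g x))]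
        refine ENNReal.ofReal_le_ofReal ?_
        have h := integral_sub_le_of_forall_dualFunctional_le hS (hm n)
          (fun x => abs_log_clampDensity_le n (g x))
        rw [integral_sub hi1 hi2]
        have h3 : ∫ x, g x * log (clampDensity n (g x)) ∂(μ₀ : Measure X) =
            ∫ x, log (clampDensity n (g x)) ∂(μ : Measure X) := integral_rnDeriv_smul hac
        simp_rw [exp_log (clampDensity_pos n _)] at h
        rwa [h3]

/-- The maximum of `0` and the first `n + 1` members of a dense family of the affine functionals. -/
noncomputable def entropyApprox (μ₀ : ProbabilityMeasure X) (n : ℕ) (μ : ProbabilityMeasure X) :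
    ℝ :=
  max 0 ((Finset.range (n + 1)).sup' Finset.nonempty_range_add_one fun j =>
    dualFunctional μ₀ (TopologicalSpace.denseSeq C(X, ℝ) j) μ)

lemma continuous_entropyApprox (μ₀ : ProbabilityMeasure X) (n : ℕ) :
    Continuous (entropyApprox μ₀ n) := by
  refine continuous_const.max ?_
  exact Continuous.finset_sup'_apply _ fun j _ => continuous_dualFunctional μ₀ _

lemma entropyApprox_nonneg (μ₀ : ProbabilityMeasure X) (n : ℕ) (μ : ProbabilityMeasure X) :
    0 ≤ entropyApprox μ₀ n μ := le_max_left _ _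

lemma monotone_entropyApprox (μ₀ : ProbabilityMeasure X) (μ : ProbabilityMeasure X) :
    Monotone fun n => entropyApprox μ₀ n μ := by
  intro m n hmn
  refine max_le_max le_rfl (Finset.sup'_mono _ ?_ _)
  exact Finset.range_mono (by omega)

/-- The relative entropy is bounded by the monotone limit of continuous functions. -/
lemma klDiv_le_iSup_entropyApprox (μ₀ μ : ProbabilityMeasure X) :
    klDiv (μ : Measure X) (μ₀ : Measure X) ≤ ⨆ n, ENNReal.ofReal (entropyApprox μ₀ n μ) := by
  set S := ⨆ n, ENNReal.ofReal (entropyApprox μ₀ n μ) with hSdef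
  by_cases hS : S = ∞
  · rw [hS]; exact le_top
  have key : ∀ f : C(X, ℝ), dualFunctional μ₀ f μ ≤ S.toReal := by
    have hcl : IsClosed {f : C(X, ℝ) | dualFunctional μ₀ f μ ≤ S.toReal} :=
      isClosed_le (continuous_dualFunctional_left μ₀ μ) continuous_const
    have hd := TopologicalSpace.denseRange_denseSeq C(X, ℝ)
    intro f
    refine hcl.closure_subset_iff.2 ?_ (hd f)
    rintro _ ⟨j, rfl⟩
    have h1 : dualFunctional μ₀ (TopologicalSpace.denseSeq C(X, ℝ) j) μ ≤ entropyApprox μ₀ j μ :=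
      le_max_of_le_right (Finset.le_sup' (fun j =>
        dualFunctional μ₀ (TopologicalSpace.denseSeq C(X, ℝ) j) μ) (by simp))
    refine h1.trans ((ENNReal.ofReal_le_iff_le_toReal hS).1 ?_)
    exact le_iSup (fun n => ENNReal.ofReal (entropyApprox μ₀ n μ)) j
  exact (klDiv_le_of_forall_dualFunctional_le key).trans (by rw [ENNReal.ofReal_toReal hS])

end DualFormula

/-! ### Empirical measures -/

section Empirical

open InformationTheory Real

variable {X : Type*} [TopologicalSpace X] [CompactSpace X] [TopologicalSpace.MetrizableSpace X]
  [MeasurableSpace X] [BorelSpace X]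

lemma integral_empiricalMeasure (N : ℕ+) (x : Fin N → X) (f : C(X, ℝ)) :
    ∫ z, f z ∂(empiricalMeasure N x : Measure X) = ((N : ℕ) : ℝ)⁻¹ * ∑ i, f (x i) := by
  have h : (empiricalMeasure N x : Measure X) =
      ((N : ℕ) : ℝ≥0∞)⁻¹ • ∑ i, Measure.dirac (x i) := rfl
  rw [h, integral_smul_measure, integral_finsetSum_measure fun i _ => integrable_continuousMap f _]
  simp

lemma empiricalMeasure_comp_perm (N : ℕ+) (x : Fin N → X) (σ : Equiv.Perm (Fin N)) :
    empiricalMeasure N (x ∘ σ) = empiricalMeasure N x := by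
  refine Subtype.ext ?_
  show ((N : ℕ) : ℝ≥0∞)⁻¹ • ∑ i, Measure.dirac ((x ∘ σ) i) =
    ((N : ℕ) : ℝ≥0∞)⁻¹ • ∑ i, Measure.dirac (x i)
  congr 1
  exact Equiv.sum_comp σ fun i => Measure.dirac (x i)

lemma natCast_pos_real (N : ℕ+) : (0 : ℝ) < ((N : ℕ) : ℝ) := by exact_mod_cast N.pos

lemma integral_empiricalLaw {N : ℕ+} (ν : ProbabilityMeasure (Fin N → X))
    {F : ProbabilityMeasure X → ℝ} (hF : Measurable F) :
    ∫ μ, F μ ∂(empiricalLaw N ν : Measure (ProbabilityMeasure X)) =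
      ∫ x, F (empiricalMeasure N x) ∂(ν : Measure (Fin N → X)) :=
  integral_map (measurable_empiricalMeasure N).aemeasurable hF.aestronglyMeasurable

lemma empiricalLaw_apply {N : ℕ+} (ν : ProbabilityMeasure (Fin N → X))
    {A : Set (ProbabilityMeasure X)} (hA : MeasurableSet A) :
    (empiricalLaw N ν : Measure (ProbabilityMeasure X)) A =
      (ν : Measure (Fin N → X)) (empiricalMeasure N ⁻¹' A) :=
  Measure.map_apply (measurable_empiricalMeasure N) hA

lemma exists_bound_of_continuous {F : ProbabilityMeasure X → ℝ} (hF : Continuous F) :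
    ∃ C, ∀ μ, |F μ| ≤ C := by
  obtain ⟨C, hC⟩ := isCompact_univ.exists_bound_of_continuousOn hF.continuousOn
  exact ⟨C, fun μ => hC μ (mem_univ _)⟩

lemma integrable_comp_empiricalMeasure {N : ℕ+} (ν : Measure (Fin N → X)) [IsFiniteMeasure ν]
    {F : ProbabilityMeasure X → ℝ} (hF : Continuous F) :
    Integrable (fun x => F (empiricalMeasure N x)) ν := by
  obtain ⟨C, hC⟩ := exists_bound_of_continuous hF
  exact Integrable.of_bound (C := C)
    (hF.measurable.comp (measurable_empiricalMeasure N)).aestronglyMeasurable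
    (Eventually.of_forall fun x => hC _)

lemma integral_exp_dualFunctional_le_one (μ₀ : ProbabilityMeasure X) (N : ℕ+) (f : C(X, ℝ)) :
    ∫ x, exp ((N : ℕ) * dualFunctional μ₀ f (empiricalMeasure N x))
      ∂(prodMeasure N μ₀ : Measure (Fin N → X)) ≤ 1 := by
  set c := ∫ x, (exp (f x) - 1) ∂(μ₀ : Measure X) with hc
  have hN := natCast_pos_real N
  let e : C(X, ℝ) := ⟨fun x => exp (f x), by fun_prop⟩
  have hexp : ∫ x, exp (f x) ∂(μ₀ : Measure X) = 1 + c := by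
    have hei : Integrable (fun x => exp (f x)) (μ₀ : Measure X) := integrable_continuousMap e _
    rw [hc, integral_sub hei (integrable_const _)]
    simp
  have h : ∀ x : Fin N → X, exp ((N : ℕ) * dualFunctional μ₀ f (empiricalMeasure N x)) =
      exp (-((N : ℕ) * c)) * ∏ i, exp (f (x i)) := by
    intro x
    rw [dualFunctional, integral_empiricalMeasure, ← exp_sum, ← exp_add, ← hc]
    congr 1
    field_simp
    ring
  simp_rw [h]
  rw [integral_const_mul]
  have hpi : ∫ x : Fin N → X, ∏ i, exp (f (x i)) ∂(prodMeasure N μ₀ : Measure (Fin N → X)) =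
      (1 + c) ^ (N : ℕ) := by
    have := integral_fintype_prod_eq_prod (𝕜 := ℝ) (μ := fun _ : Fin N => (μ₀ : Measure X))
      fun (_ : Fin N) (x : X) => exp (f x)
    rw [Finset.prod_const, hexp, Finset.card_univ, Fintype.card_fin] at this
    exact this
  rw [hpi, exp_neg, exp_nat_mul, inv_mul_le_one₀ (by positivity)]
  have h1 : 0 ≤ 1 + c := hexp ▸ integral_nonneg fun x => (exp_pos _).le
  exact pow_le_pow_left₀ h1 (by linarith [add_one_le_exp c]) _

/-- The exponential of a maximum is at most the sum of the exponentials, each of integral at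
most `1`; the extra summand `1` accounts for the maximum with `0`. -/
lemma integral_exp_entropyApprox_le (μ₀ : ProbabilityMeasure X) (N : ℕ+) (n : ℕ) :
    ∫ x, exp ((N : ℕ) * entropyApprox μ₀ n (empiricalMeasure N x))
      ∂(prodMeasure N μ₀ : Measure (Fin N → X)) ≤ n + 2 := by
  have hi : ∀ f : C(X, ℝ), Integrable
      (fun x => exp ((N : ℕ) * dualFunctional μ₀ f (empiricalMeasure N x)))
      (prodMeasure N μ₀ : Measure (Fin N → X)) := fun f =>
    integrable_comp_empiricalMeasure (F := fun μ => exp ((N : ℕ) * dualFunctional μ₀ f μ)) _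
      ((continuous_dualFunctional μ₀ f).const_mul _).rexp
  have hs := integrable_finsetSum (Finset.range (n + 1)) fun j _ =>
    hi (TopologicalSpace.denseSeq C(X, ℝ) j)
  have hle : ∀ x : Fin N → X, exp ((N : ℕ) * entropyApprox μ₀ n (empiricalMeasure N x)) ≤
      1 + ∑ j ∈ Finset.range (n + 1), exp ((N : ℕ) * dualFunctional μ₀
        (TopologicalSpace.denseSeq C(X, ℝ) j) (empiricalMeasure N x)) := by
    intro x
    have hsum : 0 ≤ ∑ j ∈ Finset.range (n + 1), exp ((N : ℕ) * dualFunctional μ₀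
        (TopologicalSpace.denseSeq C(X, ℝ) j) (empiricalMeasure N x)) :=
      Finset.sum_nonneg fun _ _ => (exp_pos _).le
    unfold entropyApprox
    rcases le_total 0 ((Finset.range (n + 1)).sup' Finset.nonempty_range_add_one fun j =>
      dualFunctional μ₀ (TopologicalSpace.denseSeq C(X, ℝ) j) (empiricalMeasure N x)) with h | h
    · rw [max_eq_right h]
      obtain ⟨j, hj, hj'⟩ := Finset.exists_mem_eq_sup' (Finset.nonempty_range_add_one (n := n))
        fun j => dualFunctional μ₀ (TopologicalSpace.denseSeq C(X, ℝ) j) (empiricalMeasure N x)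
      rw [hj']
      have := Finset.single_le_sum (f := fun j => exp ((N : ℕ) * dualFunctional μ₀
        (TopologicalSpace.denseSeq C(X, ℝ) j) (empiricalMeasure N x)))
        (fun _ _ => (exp_pos _).le) hj
      linarith
    · rw [max_eq_left h]; simpa using hsum
  have hs1 : Integrable (fun x => 1 + ∑ j ∈ Finset.range (n + 1), exp ((N : ℕ) *
      dualFunctional μ₀ (TopologicalSpace.denseSeq C(X, ℝ) j) (empiricalMeasure N x)))
      (prodMeasure N μ₀ : Measure (Fin N → X)) := (integrable_const _).add hs
  refine (integral_mono (integrable_comp_empiricalMeasure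
    (F := fun μ => exp ((N : ℕ) * entropyApprox μ₀ n μ)) _
      ((continuous_entropyApprox μ₀ n).const_mul _).rexp)
    hs1 hle).trans ?_
  rw [integral_add (integrable_const _) hs, integral_finsetSum _ fun j _ => hi _]
  have h1 := Finset.sum_le_sum fun j (_ : j ∈ Finset.range (n + 1)) =>
    integral_exp_dualFunctional_le_one μ₀ N (TopologicalSpace.denseSeq C(X, ℝ) j)
  simp only [Finset.sum_const, Finset.card_range, nsmul_eq_mul, mul_one] at h1
  push_cast at h1
  simp only [integral_const, probReal_univ, smul_eq_mul, mul_one]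
  linarith

lemma integral_entropyApprox_le {μ₀ : ProbabilityMeasure X} {N : ℕ+}
    {ν : ProbabilityMeasure (Fin N → X)}
    (hkl : klDiv (ν : Measure (Fin N → X)) (prodMeasure N μ₀ : Measure (Fin N → X)) ≠ ∞) (n : ℕ) :
    ∫ μ, entropyApprox μ₀ n μ ∂(empiricalLaw N ν : Measure (ProbabilityMeasure X)) ≤
      (klDiv (ν : Measure (Fin N → X)) (prodMeasure N μ₀ : Measure (Fin N → X))).toReal / (N : ℕ)
        + log (n + 2) / (N : ℕ) := by
  have hN := natCast_pos_real N
  have hexp := integrable_comp_empiricalMeasure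
    (F := fun μ => exp ((N : ℕ) * entropyApprox μ₀ n μ))
    (prodMeasure N μ₀ : Measure (Fin N → X)) ((continuous_entropyApprox μ₀ n).const_mul _).rexp
  have h := integral_le_toReal_klDiv_add_log hkl MeasurableSet.univ (by simp)
    (integrable_comp_empiricalMeasure (F := fun μ => (N : ℕ) * entropyApprox μ₀ n μ)
      (ν : Measure (Fin N → X)) ((continuous_entropyApprox μ₀ n).const_mul _)) hexp.integrableOn
  rw [setIntegral_univ, integral_const_mul] at h
  have h2 : log (∫ x, exp ((N : ℕ) * entropyApprox μ₀ n (empiricalMeasure N x))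
      ∂(prodMeasure N μ₀ : Measure (Fin N → X))) ≤ log (n + 2) :=
    log_le_log (integral_exp_pos hexp) (integral_exp_entropyApprox_le μ₀ N n)
  rw [integral_empiricalLaw ν (continuous_entropyApprox μ₀ n).measurable, ← add_div,
    le_div_iff₀ hN]
  linarith

/-- Lower semicontinuity of the mean entropy along converging laws of empirical measures. -/
lemma lintegral_iSup_entropyApprox_le {μ₀ : ProbabilityMeasure X} {φ : ℕ → ℕ+}
    (hφ : Tendsto φ atTop atTop) (ν : (k : ℕ) → ProbabilityMeasure (Fin (φ k) → X))
    (hkl : ∀ k, klDiv (ν k : Measure (Fin (φ k) → X))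
      (prodMeasure (φ k) μ₀ : Measure (Fin (φ k) → X)) ≠ ∞) {d : ℕ → ℝ} {D : ℝ}
    (hd : ∀ k, (klDiv (ν k : Measure (Fin (φ k) → X))
      (prodMeasure (φ k) μ₀ : Measure (Fin (φ k) → X))).toReal / (φ k : ℕ) ≤ d k)
    (hlim : Tendsto d atTop (𝓝 D)) {Γ : ProbabilityMeasure (ProbabilityMeasure X)}
    (hΓ : Tendsto (fun k => empiricalLaw (φ k) (ν k)) atTop (𝓝 Γ)) :
    ∫⁻ μ, ⨆ n, ENNReal.ofReal (entropyApprox μ₀ n μ) ∂(Γ : Measure (ProbabilityMeasure X)) ≤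
      ENNReal.ofReal D := by
  rw [lintegral_iSup (fun n => (continuous_entropyApprox μ₀ n).measurable.ennreal_ofReal)
    fun m n hmn μ => ENNReal.ofReal_le_ofReal (monotone_entropyApprox μ₀ μ hmn)]
  refine iSup_le fun n => ?_
  let F : C(ProbabilityMeasure X, ℝ) := ⟨entropyApprox μ₀ n, continuous_entropyApprox μ₀ n⟩
  rw [← ofReal_integral_eq_lintegral_ofReal (f := entropyApprox μ₀ n) (integrable_continuousMap F _)
    (Eventually.of_forall fun μ => entropyApprox_nonneg μ₀ n μ)]
  refine ENNReal.ofReal_le_ofReal ?_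
  have h1 : Tendsto (fun k => ∫ μ, F μ ∂(empiricalLaw (φ k) (ν k) :
      Measure (ProbabilityMeasure X))) atTop (𝓝 (∫ μ, F μ ∂(Γ : Measure _))) :=
    ((continuous_integral_probabilityMeasure F).tendsto Γ).comp hΓ
  have h2 : Tendsto (fun k => ((φ k : ℕ) : ℝ)) atTop atTop :=
    tendsto_natCast_atTop_atTop.comp (tendsto_PNat_val_atTop_atTop.comp hφ)
  have h3 : Tendsto (fun k => d k + log (n + 2) / ((φ k : ℕ) : ℝ)) atTop (𝓝 (D + 0)) :=
    hlim.add (h2.const_div_atTop _)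
  rw [add_zero] at h3
  refine le_of_tendsto_of_tendsto' h1 h3 fun k => ?_
  exact (integral_entropyApprox_le (hkl k) n).trans (by gcongr; exact hd k)

/-! ### The weak law of large numbers for empirical measures -/

lemma integral_prodMeasure_eval (μ : ProbabilityMeasure X) (N : ℕ+) (f : C(X, ℝ)) (i : Fin N) :
    ∫ x, f (x i) ∂(prodMeasure N μ : Measure (Fin N → X)) = ∫ x, f x ∂(μ : Measure X) :=
  integral_comp_eval (μ := fun _ : Fin N => (μ : Measure X)) f.continuous.aestronglyMeasurable

lemma integral_sq_empiricalMeasure_sub (μ : ProbabilityMeasure X) (N : ℕ+) (f : C(X, ℝ)) :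
    ∫ x, (∫ z, f z ∂(empiricalMeasure N x : Measure X) - ∫ z, f z ∂(μ : Measure X)) ^ 2
      ∂(prodMeasure N μ : Measure (Fin N → X)) =
    ProbabilityTheory.variance f (μ : Measure X) / (N : ℕ) := by
  have hN := natCast_pos_real N
  have hm : ∀ i : Fin N, MemLp f 2 (μ : Measure X) := fun _ => by
    obtain ⟨C, hC⟩ := isCompact_univ.exists_bound_of_continuousOn f.continuous.continuousOn
    exact MemLp.of_bound f.continuous.aestronglyMeasurable C
      (Eventually.of_forall fun x => hC x (mem_univ _))
  have hi : ∀ i : Fin N, Integrable (fun x : Fin N → X => f (x i))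
      (prodMeasure N μ : Measure (Fin N → X)) := fun i =>
    integrable_comp_eval (μ := fun _ : Fin N => (μ : Measure X)) (integrable_continuousMap f _)
  have hv := ProbabilityTheory.variance_sum_pi (μ := fun _ : Fin N => (μ : Measure X))
    (X := fun _ => f) hm
  rw [Finset.sum_const, Finset.card_univ, Fintype.card_fin, nsmul_eq_mul] at hv
  have hmean : ∫ x, ((∑ i, fun ω : Fin N → X => f (ω i)) : (Fin N → X) → ℝ) x
      ∂(Measure.pi fun _ : Fin N => (μ : Measure X)) = (N : ℕ) * ∫ z, f z ∂(μ : Measure X) := by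
    simp only [Finset.sum_apply]
    refine (integral_finsetSum _ fun i _ => hi i).trans ?_
    rw [Finset.sum_congr rfl fun i _ => integral_prodMeasure_eval μ N f i]
    simp
  have ham : AEMeasurable (∑ i, fun ω : Fin N → X => f (ω i))
      (Measure.pi fun _ : Fin N => (μ : Measure X)) :=
    Finset.aemeasurable_sum _ fun i _ => (hi i).aemeasurable
  rw [ProbabilityTheory.variance_eq_integral ham, hmean] at hv
  have hpt : ∀ x : Fin N → X, (∫ z, f z ∂(empiricalMeasure N x : Measure X) -
      ∫ z, f z ∂(μ : Measure X)) ^ 2 = (((N : ℕ) : ℝ)⁻¹) ^ 2 *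
      (((∑ i, fun ω : Fin N → X => f (ω i)) : (Fin N → X) → ℝ) x -
        (N : ℕ) * ∫ z, f z ∂(μ : Measure X)) ^ 2 := by
    intro x
    rw [integral_empiricalMeasure, Finset.sum_apply, ← mul_pow, mul_sub,
      inv_mul_cancel_left₀ hN.ne']
  simp_rw [hpt]
  rw [integral_const_mul]
  refine (congrArg _ hv).trans ?_
  field_simp

lemma probabilityMeasure_ext_of_denseSeq {μ ν : ProbabilityMeasure X}
    (h : ∀ j, ∫ x, TopologicalSpace.denseSeq C(X, ℝ) j x ∂(μ : Measure X) =
      ∫ x, TopologicalSpace.denseSeq C(X, ℝ) j x ∂(ν : Measure X)) : μ = ν := by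
  have hf := Continuous.ext_on (TopologicalSpace.denseRange_denseSeq C(X, ℝ))
    (continuous_integral_continuousMap (μ : Measure X))
    (continuous_integral_continuousMap (ν : Measure X)) (by rintro _ ⟨j, rfl⟩; exact h j)
  exact Subtype.ext (ext_of_forall_integral_eq_of_IsFiniteMeasure (μ := (μ : Measure X))
    (ν := (ν : Measure X)) fun f => congrFun hf f.toContinuousMap)

lemma eq_diracProba_of_ae_eq {Y : Type*} [MeasurableSpace Y] {Γ : ProbabilityMeasure Y} {a : Y}
    (h : ∀ᵐ y ∂(Γ : Measure Y), y = a) : Γ = diracProba a := by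
  refine Subtype.ext ?_
  have h1 : (Γ : Measure Y).map id = (Γ : Measure Y).map fun _ => a := Measure.map_congr h
  rw [Measure.map_id, Measure.map_const] at h1
  simpa [diracProba] using h1

/-- Under `μ^{⊗N}` the empirical measures converge in law to the constant `μ`. -/
lemma tendsto_empiricalLaw_prodMeasure (μ : ProbabilityMeasure X) :
    Tendsto (fun N : ℕ+ => empiricalLaw N (prodMeasure N μ)) atTop (𝓝 (diracProba μ)) := by
  refine tendsto_of_subseq_tendsto fun ns hns => ?_
  obtain ⟨Γ, φ, hφ, hΓ⟩ := CompactSpace.tendsto_subseq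
    fun k => empiricalLaw (ns k) (prodMeasure (ns k) μ)
  refine ⟨φ, ?_⟩
  suffices h : Γ = diracProba μ by rw [← h]; exact hΓ
  refine eq_diracProba_of_ae_eq ?_
  -- The variance of `δ_N(f)` is of order `1/N`, so it vanishes under any limit law `Γ`.
  have key : ∀ f : C(X, ℝ), ∀ᵐ ν : ProbabilityMeasure X ∂(Γ : Measure (ProbabilityMeasure X)),
      ∫ x, f x ∂(ν : Measure X) = ∫ x, f x ∂(μ : Measure X) := by
    intro f
    let F : C(ProbabilityMeasure X, ℝ) :=
      ⟨fun ν => (∫ x, f x ∂(ν : Measure X) - ∫ x, f x ∂(μ : Measure X)) ^ 2,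
        ((continuous_integral_probabilityMeasure f).sub continuous_const).pow 2⟩
    have h1 : Tendsto (fun k => ∫ ν, F ν ∂(empiricalLaw (ns (φ k)) (prodMeasure (ns (φ k)) μ) :
        Measure (ProbabilityMeasure X))) atTop (𝓝 (∫ ν, F ν ∂(Γ : Measure _))) :=
      ((continuous_integral_probabilityMeasure F).tendsto Γ).comp hΓ
    have h2 : Tendsto (fun k => ((ns (φ k) : ℕ) : ℝ)) atTop atTop :=
      tendsto_natCast_atTop_atTop.comp
        (tendsto_PNat_val_atTop_atTop.comp (hns.comp hφ.tendsto_atTop))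
    have h3 : ∀ k, ∫ ν, F ν ∂(empiricalLaw (ns (φ k)) (prodMeasure (ns (φ k)) μ) :
        Measure (ProbabilityMeasure X)) =
        ProbabilityTheory.variance f (μ : Measure X) / (ns (φ k) : ℕ) := fun k => by
      rw [integral_empiricalLaw _ F.continuous.measurable]
      exact integral_sq_empiricalMeasure_sub μ _ f
    simp_rw [h3] at h1
    have h4 : ∫ ν, F ν ∂(Γ : Measure _) = 0 :=
      tendsto_nhds_unique h1 (h2.const_div_atTop _)
    rw [integral_eq_zero_iff_of_nonneg (f := F) (fun ν => sq_nonneg _)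
      (integrable_continuousMap F _)] at h4
    filter_upwards [h4] with ν hν
    have hν' : (∫ x, f x ∂(ν : Measure X) - ∫ x, f x ∂(μ : Measure X)) ^ 2 = 0 := hν
    exact sub_eq_zero.1 (pow_eq_zero_iff two_ne_zero |>.1 hν')
  filter_upwards [ae_all_iff.2 fun j => key (TopologicalSpace.denseSeq C(X, ℝ) j)] with ν hν
  exact probabilityMeasure_ext_of_denseSeq hν

end Empirical

/-! ### Integrals of extended-real functions with finite values -/

section ExtIntegral

variable {Ω : Type*} [MeasurableSpace Ω]

lemma extIntegral_eq_coe_of_ae_eq {f : Ω → EReal} {g : Ω → ℝ} {μ : Measure Ω}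
    (hfg : ∀ᵐ ω ∂μ, f ω = (g ω : EReal)) (hg : Integrable g μ) :
    extIntegral f μ = ((∫ ω, g ω ∂μ : ℝ) : EReal) := by
  have hm : AEMeasurable f μ :=
    (measurable_coe_real_ereal.comp_aemeasurable hg.aemeasurable).congr
      (by filter_upwards [hfg] with ω h using h.symm)
  have hp : ∫⁻ ω, (f ω).toENNReal ∂μ = ∫⁻ ω, ENNReal.ofReal (g ω) ∂μ :=
    lintegral_congr_ae (by filter_upwards [hfg] with ω h; rw [h, EReal.real_coe_toENNReal])
  have hn : ∫⁻ ω, (-f ω).toENNReal ∂μ = ∫⁻ ω, ENNReal.ofReal (-g ω) ∂μ :=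
    lintegral_congr_ae (by
      filter_upwards [hfg] with ω h; rw [h, ← EReal.coe_neg, EReal.real_coe_toENNReal])
  have hp' : ∫⁻ ω, ENNReal.ofReal (g ω) ∂μ ≠ ∞ := hg.lintegral_lt_top.ne
  have hn' : ∫⁻ ω, ENNReal.ofReal (-g ω) ∂μ ≠ ∞ := hg.neg.lintegral_lt_top.ne
  rw [extIntegral, if_pos ⟨hm, by rwa [hp]⟩, hp, hn,
    integral_eq_lintegral_pos_part_sub_lintegral_neg_part hg, EReal.coe_sub,
    EReal.coe_ennreal_toReal hp', EReal.coe_ennreal_toReal hn']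

/-- If the extended integral of `f` is a real number, then `f` is almost everywhere finite and
integrable. -/
lemma integrable_toReal_of_extIntegral_eq_coe {f : Ω → EReal} {μ : Measure Ω} {e : ℝ}
    (h : extIntegral f μ = (e : EReal)) :
    (∀ᵐ ω ∂μ, f ω = ((f ω).toReal : EReal)) ∧ Integrable (fun ω => (f ω).toReal) μ ∧
      ∫ ω, (f ω).toReal ∂μ = e := by
  by_cases hc : AEMeasurable f μ ∧ ∫⁻ ω, (f ω).toENNReal ∂μ ≠ ∞
  swap
  · rw [extIntegral, if_neg hc] at h
    exact absurd h (EReal.coe_ne_top e).symm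
  have hn : ∫⁻ ω, (-f ω).toENNReal ∂μ ≠ ∞ := by
    intro hn
    rw [extIntegral, if_pos hc, hn] at h
    simp at h
  have h1 : ∀ᵐ ω ∂μ, (f ω).toENNReal < ∞ := ae_lt_top' hc.1.ereal_toENNReal hc.2
  have h2 : ∀ᵐ ω ∂μ, (-f ω).toENNReal < ∞ := ae_lt_top' hc.1.neg.ereal_toENNReal hn
  have hae : ∀ᵐ ω ∂μ, f ω = ((f ω).toReal : EReal) := by
    filter_upwards [h1, h2] with ω h1 h2
    rw [EReal.coe_toReal]
    · exact EReal.toENNReal_ne_top_iff.1 h1.ne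
    · intro hb
      rw [hb] at h2
      simp at h2
  have hi : Integrable (fun ω => (f ω).toReal) μ := by
    refine ⟨hc.1.ereal_toReal.aestronglyMeasurable, ?_⟩
    rw [hasFiniteIntegral_iff_norm]
    refine lt_of_le_of_lt (b := ∫⁻ ω, ((f ω).toENNReal + (-f ω).toENNReal) ∂μ)
      (lintegral_mono_ae ?_) ?_
    · filter_upwards [hae] with ω h
      rw [h, ← EReal.coe_neg, EReal.real_coe_toENNReal, EReal.real_coe_toENNReal, EReal.toReal_coe,
        Real.norm_eq_abs]
      rcases abs_cases (f ω).toReal with ⟨h', -⟩ | ⟨h', -⟩ <;> rw [h']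
      · exact le_self_add
      · exact le_add_self
    · rw [lintegral_add_left' hc.1.ereal_toENNReal]
      exact ENNReal.add_lt_top.2 ⟨hc.2.lt_top, hn.lt_top⟩
  refine ⟨hae, hi, ?_⟩
  rw [extIntegral_eq_coe_of_ae_eq hae hi] at h
  exact_mod_cast h

end ExtIntegral

/-! ### Symmetry -/

section Symmetry

variable {X : Type*} [MeasurableSpace X]

lemma coe_piCongrLeft_symm {N : ℕ+} (σ : Equiv.Perm (Fin N)) :
    ⇑(MeasurableEquiv.piCongrLeft (fun _ : Fin N => X) σ.symm) = fun x => x ∘ σ := by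
  funext x i
  have h := MeasurableEquiv.piCongrLeft_apply_apply σ.symm (β := fun _ : Fin N => X) x (σ i)
  rwa [Equiv.symm_apply_apply] at h

lemma measurableEmbedding_comp_perm {N : ℕ+} (σ : Equiv.Perm (Fin N)) :
    MeasurableEmbedding fun x : Fin N → X => x ∘ σ := by
  rw [← coe_piCongrLeft_symm]
  exact (MeasurableEquiv.piCongrLeft (fun _ : Fin N => X) σ.symm).measurableEmbedding

lemma measurePreserving_comp_perm (N : ℕ+) (μ : ProbabilityMeasure X) (σ : Equiv.Perm (Fin N)) :
    MeasurePreserving (fun x : Fin N → X => x ∘ σ) (prodMeasure N μ : Measure (Fin N → X))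
      (prodMeasure N μ : Measure (Fin N → X)) := by
  rw [← coe_piCongrLeft_symm]
  exact measurePreserving_piCongrLeft (fun _ : Fin N => (μ : Measure X)) σ.symm

lemma isSymmetric_prodMeasure (N : ℕ+) (μ : ProbabilityMeasure X) :
    IsSymmetric (prodMeasure N μ) := fun σ => (measurePreserving_comp_perm N μ σ).map_eq

lemma isSymmetric_of_eq_withDensity {N : ℕ+} {μ : ProbabilityMeasure X}
    {ν : ProbabilityMeasure (Fin N → X)} {f : (Fin N → X) → ℝ≥0∞}
    (hν : (ν : Measure (Fin N → X)) = (prodMeasure N μ : Measure (Fin N → X)).withDensity f)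
    (hf : ∀ (σ : Equiv.Perm (Fin N)) x, f (x ∘ σ) = f x) : IsSymmetric ν := by
  intro σ
  have he := measurableEmbedding_comp_perm (X := X) σ
  ext B hB
  rw [Measure.map_apply he.measurable hB, hν, withDensity_apply _ hB,
    withDensity_apply _ (he.measurable hB),
    ← (measurePreserving_comp_perm N μ σ).setLIntegral_comp_preimage_emb he f B]
  simp only [hf]

lemma isSymmetric_of_eq_cond {N : ℕ+} {μ ν : ProbabilityMeasure (Fin N → X)}
    (hμ : IsSymmetric μ) {A : Set (Fin N → X)} (hA : MeasurableSet A)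
    (hAs : ∀ (σ : Equiv.Perm (Fin N)) x, x ∘ σ ∈ A ↔ x ∈ A)
    (hν : (ν : Measure (Fin N → X)) = ProbabilityTheory.cond (μ : Measure (Fin N → X)) A) :
    IsSymmetric ν := by
  intro σ
  have he := measurableEmbedding_comp_perm (X := X) σ
  ext B hB
  rw [Measure.map_apply he.measurable hB, hν, ProbabilityTheory.cond_apply hA,
    ProbabilityTheory.cond_apply hA]
  congr 1
  conv_rhs => rw [← hμ σ]
  rw [Measure.map_apply he.measurable (hA.inter hB)]
  congr 1
  ext x
  simp [hAs]

end Symmetry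

/-! ### Energy and entropy of particle distributions -/

section Energy

open InformationTheory Real

variable {X : Type*} [MeasurableSpace X]

/-- The mean energy as a Bochner integral; it agrees with `meanEnergy` on distributions of finite
entropy if the partition functions are finite for inverse temperatures of both signs. -/
noncomputable def realEnergy (H : (N : ℕ+) → (Fin N → X) → EReal) (N : ℕ+)
    (ν : ProbabilityMeasure (Fin N → X)) : ℝ :=
  (∫ x, (H N x).toReal ∂(ν : Measure (Fin N → X))) / (N : ℕ)

/-- The mean entropy as a real number, with junk value `0` if the entropy is infinite. -/
noncomputable def realEntropy (μ₀ : ProbabilityMeasure X) (N : ℕ+)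
    (ν : ProbabilityMeasure (Fin N → X)) : ℝ :=
  (relEntropy ν (prodMeasure N μ₀)).toReal / (N : ℕ)

lemma realEntropy_nonneg (μ₀ : ProbabilityMeasure X) (N : ℕ+)
    (ν : ProbabilityMeasure (Fin N → X)) : 0 ≤ realEntropy μ₀ N ν :=
  div_nonneg ENNReal.toReal_nonneg (Nat.cast_nonneg _)

lemma meanEntropy_eq_coe {μ₀ : ProbabilityMeasure X} {N : ℕ+}
    {ν : ProbabilityMeasure (Fin N → X)} (h : relEntropy ν (prodMeasure N μ₀) ≠ ∞) :
    meanEntropy μ₀ N ν = (realEntropy μ₀ N ν : EReal) := by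
  rw [meanEntropy, realEntropy, EReal.coe_div, EReal.coe_ennreal_toReal h, EReal.coe_natCast]

lemma relEntropy_prodMeasure (μ₀ μ : ProbabilityMeasure X) (N : ℕ+) :
    relEntropy (prodMeasure N μ) (prodMeasure N μ₀) = (N : ℕ) * relEntropy μ μ₀ :=
  klDiv_pi_const _ _ _

lemma relEntropy_prodMeasure_ne_top {μ₀ μ : ProbabilityMeasure X} (h : relEntropy μ μ₀ ≠ ∞)
    (N : ℕ+) : relEntropy (prodMeasure N μ) (prodMeasure N μ₀) ≠ ∞ := by
  rw [relEntropy_prodMeasure]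
  exact ENNReal.mul_ne_top (by simp) h

lemma realEntropy_prodMeasure (μ₀ μ : ProbabilityMeasure X) (N : ℕ+) :
    realEntropy μ₀ N (prodMeasure N μ) = (relEntropy μ μ₀).toReal := by
  have hN : ((N : ℕ) : ℝ) ≠ 0 := by simp
  rw [realEntropy, relEntropy_prodMeasure, ENNReal.toReal_mul, ENNReal.toReal_natCast,
    mul_div_cancel_left₀ _ hN]

/-- Exponential bounds `Z_{N,β} ≤ e^{N K(β)}` on the partition functions for all `β > β₀`, where
`β₀ < 0`. -/
structure ExponentialBound (μ₀ : ProbabilityMeasure X) (H : (N : ℕ+) → (Fin N → X) → EReal)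
    (β₀ : ℝ) (K : ℝ → ℝ) : Prop where
  aemeasurable : ∀ N, AEMeasurable (H N) (prodMeasure N μ₀ : Measure (Fin N → X))
  neg : β₀ < 0
  bound : ∀ β, β₀ < β → ∀ N : ℕ+,
    partitionFunction μ₀ H β N ≤ ENNReal.ofReal (exp ((N : ℕ) * K β))

namespace ExponentialBound

variable {μ₀ : ProbabilityMeasure X} {H : (N : ℕ+) → (Fin N → X) → EReal} {β₀ : ℝ} {K : ℝ → ℝ}

lemma ae_eq_toReal (B : ExponentialBound μ₀ H β₀ K) (N : ℕ+) :
    ∀ᵐ x ∂(prodMeasure N μ₀ : Measure (Fin N → X)), H N x = ((H N x).toReal : EReal) := by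
  have key : ∀ β, β₀ < β → ∀ᵐ x ∂(prodMeasure N μ₀ : Measure (Fin N → X)),
      EReal.exp (-((β : EReal) * H N x)) < ∞ := by
    intro β hβ
    have hm : AEMeasurable (fun x => EReal.exp (-((β : EReal) * H N x)))
        (prodMeasure N μ₀ : Measure (Fin N → X)) :=
      EReal.measurable_exp.comp_aemeasurable ((B.aemeasurable N).const_mul _).neg
    exact ae_lt_top' hm (ne_top_of_le_ne_top ENNReal.ofReal_ne_top (B.bound β hβ N))
  have hneg : β₀ / 2 < 0 := by linarith [B.neg]
  filter_upwards [key (β₀ / 2) (by linarith [B.neg]), key 1 (by linarith [B.neg])] with x h1 h2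
  rw [EReal.coe_toReal]
  · intro h
    rw [h, EReal.coe_mul_top_of_neg hneg] at h1
    simp at h1
  · intro h
    rw [h, EReal.coe_mul_bot_of_pos one_pos] at h2
    simp at h2

lemma ae_exp_eq (B : ExponentialBound μ₀ H β₀ K) (β : ℝ) (N : ℕ+) :
    ∀ᵐ x ∂(prodMeasure N μ₀ : Measure (Fin N → X)),
      EReal.exp (-((β : EReal) * H N x)) = ENNReal.ofReal (exp (-β * (H N x).toReal)) := by
  filter_upwards [B.ae_eq_toReal N] with x hx
  conv_lhs => rw [hx]
  rw [← EReal.coe_mul, ← EReal.coe_neg, EReal.exp_coe, neg_mul]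

lemma aemeasurable_toReal (B : ExponentialBound μ₀ H β₀ K) (N : ℕ+) :
    AEMeasurable (fun x => (H N x).toReal) (prodMeasure N μ₀ : Measure (Fin N → X)) :=
  (B.aemeasurable N).ereal_toReal

lemma integrable_exp (B : ExponentialBound μ₀ H β₀ K) {β : ℝ} (hβ : β₀ < β) (N : ℕ+) :
    Integrable (fun x => exp (-β * (H N x).toReal))
      (prodMeasure N μ₀ : Measure (Fin N → X)) := by
  rw [← lintegral_ofReal_ne_top_iff_integrable
    ((B.aemeasurable_toReal N).const_mul _).exp.aestronglyMeasurable
    (Eventually.of_forall fun x => (exp_pos _).le), ← lintegral_congr_ae (B.ae_exp_eq β N)]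
  exact ne_top_of_le_ne_top ENNReal.ofReal_ne_top (B.bound β hβ N)

lemma boltzmannMeasure_apply (B : ExponentialBound μ₀ H β₀ K) {β : ℝ} (hβ : β₀ < β) (N : ℕ+)
    {A : Set (Fin N → X)} (hA : MeasurableSet A) :
    boltzmannMeasure μ₀ H β N A = ENNReal.ofReal
      (∫ x in A, exp (-β * (H N x).toReal) ∂(prodMeasure N μ₀ : Measure (Fin N → X))) := by
  rw [boltzmannMeasure, withDensity_apply _ hA, lintegral_congr_ae
    (ae_restrict_of_ae (B.ae_exp_eq β N)), ofReal_integral_eq_lintegral_ofReal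
    (B.integrable_exp hβ N).integrableOn (Eventually.of_forall fun x => (exp_pos _).le)]

lemma log_integral_exp_le (B : ExponentialBound μ₀ H β₀ K) {β : ℝ} (hβ : β₀ < β) (N : ℕ+) :
    log (∫ x, exp (-β * (H N x).toReal) ∂(prodMeasure N μ₀ : Measure (Fin N → X))) ≤
      (N : ℕ) * K β := by
  have h := B.bound β hβ N
  rw [partitionFunction, lintegral_congr_ae (B.ae_exp_eq β N),
    ← ofReal_integral_eq_lintegral_ofReal (B.integrable_exp hβ N)
      (Eventually.of_forall fun x => (exp_pos _).le),
    ENNReal.ofReal_le_ofReal_iff (exp_pos _).le] at h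
  exact (log_le_iff_le_exp (integral_exp_pos (B.integrable_exp hβ N))).2 h

lemma integrable_toReal (B : ExponentialBound μ₀ H β₀ K) {N : ℕ+}
    {ν : ProbabilityMeasure (Fin N → X)} (hν : relEntropy ν (prodMeasure N μ₀) ≠ ∞) :
    Integrable (fun x => (H N x).toReal) (ν : Measure (Fin N → X)) := by
  have hneg := B.neg
  refine integrable_of_klDiv_ne_top hν (B.aemeasurable_toReal N).aestronglyMeasurable
    (ε := -(β₀ / 2)) (by linarith) ?_ ?_
  · exact B.integrable_exp (by linarith) N
  · exact B.integrable_exp (by linarith) N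

lemma meanEnergy_eq_coe (B : ExponentialBound μ₀ H β₀ K) {N : ℕ+}
    {ν : ProbabilityMeasure (Fin N → X)} (hν : relEntropy ν (prodMeasure N μ₀) ≠ ∞) :
    meanEnergy H N ν = (realEnergy H N ν : EReal) := by
  have hac := (klDiv_ne_top_iff.1 hν).1
  rw [meanEnergy, extIntegral_eq_coe_of_ae_eq (hac.ae_le (B.ae_eq_toReal N))
    (B.integrable_toReal hν), realEnergy, EReal.coe_div, EReal.coe_natCast]

/-- The Gibbs variational inequality for the mean free energy. -/
lemma neg_log_div_le (B : ExponentialBound μ₀ H β₀ K) {β : ℝ} (hβ : β₀ < β) {N : ℕ+}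
    {ν : ProbabilityMeasure (Fin N → X)} (hν : relEntropy ν (prodMeasure N μ₀) ≠ ∞)
    {A : Set (Fin N → X)} (hA : MeasurableSet A) (hνA : (ν : Measure (Fin N → X)) Aᶜ = 0) :
    -(log (∫ x in A, exp (-β * (H N x).toReal) ∂(prodMeasure N μ₀ : Measure (Fin N → X))) /
      (N : ℕ)) ≤ β * realEnergy H N ν + realEntropy μ₀ N ν := by
  have hN : (0 : ℝ) < (N : ℕ) := by exact_mod_cast N.pos
  have h := integral_le_toReal_klDiv_add_log hν hA hνA ((B.integrable_toReal hν).const_mul (-β))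
    (B.integrable_exp hβ N).integrableOn
  rw [integral_const_mul] at h
  rw [realEnergy, realEntropy, relEntropy, ← mul_div_assoc, ← add_div, ← neg_div]
  refine div_le_div_of_nonneg_right ?_ hN.le
  linarith

lemma neg_le_add (B : ExponentialBound μ₀ H β₀ K) {β : ℝ} (hβ : β₀ < β) {N : ℕ+}
    {ν : ProbabilityMeasure (Fin N → X)} (hν : relEntropy ν (prodMeasure N μ₀) ≠ ∞) :
    -K β ≤ β * realEnergy H N ν + realEntropy μ₀ N ν := by
  have hN : (0 : ℝ) < (N : ℕ) := by exact_mod_cast N.pos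
  have h := B.neg_log_div_le hβ hν MeasurableSet.univ (by simp)
  rw [setIntegral_univ] at h
  refine le_trans (neg_le_neg ?_) h
  rw [div_le_iff₀ hN, mul_comm]
  exact B.log_integral_exp_le hβ N

lemma exists_abs_realEnergy_le (B : ExponentialBound μ₀ H β₀ K) (C : ℝ) :
    ∃ C' : ℝ, ∀ (N : ℕ+) (ν : ProbabilityMeasure (Fin N → X)),
      relEntropy ν (prodMeasure N μ₀) ≠ ∞ → realEntropy μ₀ N ν ≤ C → |realEnergy H N ν| ≤ C' := by
  have hneg := B.neg
  refine ⟨max (K 1 + C) ((K (β₀ / 2) + C) / (-(β₀ / 2))), fun N ν hν hC => abs_le.2 ⟨?_, ?_⟩⟩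
  · have := B.neg_le_add (β := 1) (by linarith) hν
    have := le_max_left (K 1 + C) ((K (β₀ / 2) + C) / (-(β₀ / 2)))
    linarith
  · refine le_max_of_le_right ?_
    have := B.neg_le_add (β := β₀ / 2) (by linarith) hν
    rw [le_div_iff₀ (by linarith)]
    linarith

/-- An upper bound on the mean free energy bounds the mean entropy: compare with an inverse
temperature `β'` of the same sign and larger modulus. -/
lemma exists_realEntropy_le (B : ExponentialBound μ₀ H β₀ K) {β : ℝ} (hβ : β₀ < β) (c : ℝ) :
    ∃ C : ℝ, ∀ (N : ℕ+) (ν : ProbabilityMeasure (Fin N → X)),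
      relEntropy ν (prodMeasure N μ₀) ≠ ∞ → β * realEnergy H N ν + realEntropy μ₀ N ν ≤ c →
        realEntropy μ₀ N ν ≤ C := by
  have hneg := B.neg
  -- Write `β = t β'` with `β' > β₀` and `t < 1`, so that `β e + d = t (β' e + d) + (1 - t) d`.
  obtain ⟨β', t, hβ', ht0, ht1, ht⟩ : ∃ β' t : ℝ, β₀ < β' ∧ 0 ≤ t ∧ t < 1 ∧ β = t * β' := by
    rcases lt_or_ge β 0 with h | h
    · have h1 : (β₀ + β) / 2 < 0 := by linarith
      refine ⟨(β₀ + β) / 2, β / ((β₀ + β) / 2), by linarith, ?_, ?_, ?_⟩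
      · exact div_nonneg_of_nonpos h.le h1.le
      · rw [div_lt_one_of_neg h1]; linarith
      · rw [div_mul_cancel₀ _ h1.ne]
    · exact ⟨2 * β, 1 / 2, by linarith, by norm_num, by norm_num, by ring⟩
  refine ⟨(c + t * K β') / (1 - t), fun N ν hν hc => ?_⟩
  have h := mul_le_mul_of_nonneg_left (B.neg_le_add hβ' hν) ht0
  rw [le_div_iff₀ (by linarith)]
  rw [ht] at hc
  linarith

end ExponentialBound

end Energy

/-! ### Subsequences of particle numbers -/

section Subsequences

lemma tendsto_succPNat_atTop : Tendsto Nat.succPNat atTop atTop :=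
  OrderIso.pnatIsoNat.symm.tendsto_atTop

lemma tendsto_of_comp_succPNat {α : Type*} {f : ℕ+ → α} {l : Filter α}
    (h : Tendsto (fun n => f (Nat.succPNat n)) atTop l) : Tendsto f atTop l := by
  have h1 : Tendsto PNat.natPred atTop atTop := OrderIso.pnatIsoNat.tendsto_atTop
  refine (h.comp h1).congr fun N => ?_
  simp

lemma tendsto_atTop_of_strictMono {φ : ℕ → ℕ+} (hφ : StrictMono φ) : Tendsto φ atTop atTop := by
  have h : StrictMono fun k => (φ k : ℕ) := fun _ _ hjk => hφ hjk
  exact tendsto_atTop_atTop_of_monotone hφ.monotone fun N => ⟨N, h.le_apply⟩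

lemma exists_strictMono_of_frequently {p : ℕ+ → Prop} (h : ∃ᶠ N in atTop, p N) :
    ∃ φ : ℕ → ℕ+, StrictMono φ ∧ ∀ k, p (φ k) := by
  obtain ⟨ns, hns, hp⟩ := exists_seq_forall_of_frequently h
  obtain ⟨ψ, -, hψ⟩ := strictMono_subseq_of_tendsto_atTop hns
  exact ⟨ns ∘ ψ, hψ, fun k => hp _⟩

lemma exists_strictMono_of_forall_eventually {p : ℕ → ℕ+ → Prop}
    (h : ∀ k, ∀ᶠ N in atTop, p k N) : ∃ φ : ℕ → ℕ+, StrictMono φ ∧ ∀ k, p k (φ k) := by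
  obtain ⟨ψ, hψ, hp⟩ := extraction_forall_of_eventually
    fun k => tendsto_succPNat_atTop.eventually (h k)
  exact ⟨fun k => Nat.succPNat (ψ k), Nat.succPNat_strictMono.comp hψ, hp⟩

/-- Extension of a dependent family from a subsequence of indices to all indices. -/
lemma exists_extend_of_injective {α : ℕ+ → Type*} {φ : ℕ → ℕ+} (hφ : Function.Injective φ)
    (ν : (k : ℕ) → α (φ k)) (ν₀ : (N : ℕ+) → α N) :
    ∃ μ : (N : ℕ+) → α N, (∀ k, μ (φ k) = ν k) ∧ ∀ N, N ∉ range φ → μ N = ν₀ N := by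
  classical
  refine ⟨fun N => if h : ∃ k, φ k = N then h.choose_spec ▸ ν h.choose else ν₀ N,
    fun k => ?_, fun N hN => dif_neg hN⟩
  have h : ∃ j, φ j = φ k := ⟨k, rfl⟩
  have key : ∀ j (hj : φ j = φ k), (hj ▸ ν j : α (φ k)) = ν k := by
    intro j hj
    obtain rfl := hφ hj
    rfl
  simp only [dif_pos h]
  exact key _ _

end Subsequences

/-! ### Convergence of energies and lower semicontinuity of the free energy -/

section FreeEnergy

open InformationTheory Real

variable {X : Type*} [TopologicalSpace X] [CompactSpace X] [TopologicalSpace.MetrizableSpace X]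
  [MeasurableSpace X] [BorelSpace X]
  {μ₀ : ProbabilityMeasure X} {H : (N : ℕ+) → (Fin N → X) → EReal}
  {E : ProbabilityMeasure X → EReal} {β₀ : ℝ} {K : ℝ → ℝ}

/-- Along a subsequence with bounded entropies and converging empirical laws the mean energies
converge: off the subsequence the distributions are taken to be `μ₀^{⊗N}`, and the exponential
bounds supply the energy bounds and the finiteness of the limit. -/
lemma tendsto_realEnergy (B : ExponentialBound μ₀ H β₀ K) (h4 : EnergyEntropyCompact μ₀ H E)
    {φ : ℕ → ℕ+} (hφ : StrictMono φ) (ν : (k : ℕ) → ProbabilityMeasure (Fin (φ k) → X))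
    (hsym : ∀ k, IsSymmetric (ν k)) (hkl : ∀ k, relEntropy (ν k) (prodMeasure (φ k) μ₀) ≠ ∞)
    {C : ℝ} (hC : ∀ k, realEntropy μ₀ (φ k) (ν k) ≤ C)
    {Γ : ProbabilityMeasure (ProbabilityMeasure X)}
    (hΓ : Tendsto (fun k => empiricalLaw (φ k) (ν k)) atTop (𝓝 Γ)) :
    (∀ᵐ μ ∂(Γ : Measure (ProbabilityMeasure X)), E μ = ((E μ).toReal : EReal)) ∧
      Integrable (fun μ => (E μ).toReal) (Γ : Measure (ProbabilityMeasure X)) ∧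
      Tendsto (fun k => realEnergy H (φ k) (ν k)) atTop
        (𝓝 (∫ μ, (E μ).toReal ∂(Γ : Measure (ProbabilityMeasure X)))) := by
  obtain ⟨μ, hμ, hμ₀⟩ := exists_extend_of_injective
    (α := fun N => ProbabilityMeasure (Fin N → X)) hφ.injective ν fun N => prodMeasure N μ₀
  have hself : ∀ N : ℕ+, relEntropy (prodMeasure N μ₀) (prodMeasure N μ₀) = 0 := fun N =>
    klDiv_self _
  have hC0 : 0 ≤ C := (realEntropy_nonneg _ _ _).trans (hC 0)
  have hall : ∀ N, IsSymmetric (μ N) ∧ relEntropy (μ N) (prodMeasure N μ₀) ≠ ∞ ∧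
      realEntropy μ₀ N (μ N) ≤ C := by
    intro N
    by_cases hN : N ∈ range φ
    · obtain ⟨k, rfl⟩ := hN
      rw [hμ]
      exact ⟨hsym k, hkl k, hC k⟩
    · rw [hμ₀ N hN, realEntropy, hself]
      exact ⟨isSymmetric_prodMeasure N μ₀, ENNReal.zero_ne_top, by simpa using hC0⟩
  obtain ⟨C', hC'⟩ := B.exists_abs_realEnergy_le C
  have hE : ∀ N, |realEnergy H N (μ N)| ≤ C' := fun N => hC' N _ (hall N).2.1 (hall N).2.2
  have hlim := h4 (max C' C) μ (fun N => (hall N).1)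
    (fun N => by
      rw [B.meanEnergy_eq_coe (hall N).2.1, EReal.coe_le_coe_iff]
      exact ((le_abs_self _).trans (hE N)).trans (le_max_left _ _))
    (fun N => by
      rw [meanEntropy_eq_coe (hall N).2.1, EReal.coe_le_coe_iff]
      exact (hall N).2.2.trans (le_max_right _ _))
    φ hφ Γ (by simpa only [hμ] using hΓ)
  have hcoe : ∀ k, meanEnergy H (φ k) (μ (φ k)) = (realEnergy H (φ k) (ν k) : EReal) := fun k => by
    rw [B.meanEnergy_eq_coe (hall _).2.1, hμ]
  simp_rw [hcoe] at hlim
  have hbd : ∀ k, |realEnergy H (φ k) (ν k)| ≤ C' := fun k => by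
    have := hE (φ k); rwa [hμ] at this
  have h1 : extIntegral E (Γ : Measure (ProbabilityMeasure X)) ≤ (C' : EReal) :=
    le_of_tendsto' hlim fun k => EReal.coe_le_coe_iff.2 (abs_le.1 (hbd k)).2
  have h2 : ((-C' : ℝ) : EReal) ≤ extIntegral E (Γ : Measure (ProbabilityMeasure X)) :=
    ge_of_tendsto' hlim fun k => EReal.coe_le_coe_iff.2 (abs_le.1 (hbd k)).1
  have h3 : extIntegral E (Γ : Measure (ProbabilityMeasure X)) =
      ((extIntegral E (Γ : Measure (ProbabilityMeasure X))).toReal : EReal) :=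
    (EReal.coe_toReal (ne_top_of_le_ne_top (EReal.coe_ne_top _) h1)
      (ne_bot_of_le_ne_bot (EReal.coe_ne_bot _) h2)).symm
  obtain ⟨ha, hi, he⟩ := integrable_toReal_of_extIntegral_eq_coe h3
  refine ⟨ha, hi, ?_⟩
  rw [he]
  rw [h3] at hlim
  exact EReal.tendsto_coe.1 hlim

/-- The macroscopic energy is finite on measures of finite entropy, and there it is the limit of
the mean energies of the product measures. -/
lemma energy_of_relEntropy_ne_top (B : ExponentialBound μ₀ H β₀ K)
    (h4 : EnergyEntropyCompact μ₀ H E) {μ : ProbabilityMeasure X} (hμ : relEntropy μ μ₀ ≠ ∞) :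
    E μ = ((E μ).toReal : EReal) ∧
      Tendsto (fun N : ℕ+ => realEnergy H N (prodMeasure N μ)) atTop (𝓝 (E μ).toReal) := by
  obtain ⟨ha, -, ht⟩ := tendsto_realEnergy B h4 Nat.succPNat_strictMono
    (fun k => prodMeasure (Nat.succPNat k) μ) (fun k => isSymmetric_prodMeasure _ _)
    (fun k => relEntropy_prodMeasure_ne_top hμ _) (fun k => (realEntropy_prodMeasure μ₀ μ _).le)
    ((tendsto_empiricalLaw_prodMeasure μ).comp tendsto_succPNat_atTop)
  have hd : ((diracProba μ : ProbabilityMeasure (ProbabilityMeasure X)) :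
    Measure (ProbabilityMeasure X)) = Measure.dirac μ := rfl
  rw [hd, ae_dirac_eq, eventually_pure] at ha
  rw [hd, integral_dirac] at ht
  exact ⟨ha, tendsto_of_comp_succPNat ht⟩

lemma scaledFreeEnergy_eq_coe {β : ℝ} {μ : ProbabilityMeasure X} (hμ : relEntropy μ μ₀ ≠ ∞)
    (hE : E μ = ((E μ).toReal : EReal)) :
    scaledFreeEnergy μ₀ E β μ = ((β * (E μ).toReal + (relEntropy μ μ₀).toReal : ℝ) : EReal) := by
  rw [scaledFreeEnergy, if_neg hμ, EReal.coe_add, EReal.coe_mul, ← hE,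
    EReal.coe_ennreal_toReal hμ]

/-- If mean free energies are asymptotically at most `c`, then every limit `Γ` of the empirical
laws charges measures of macroscopic free energy at most `c`. -/
lemma exists_scaledFreeEnergy_le (B : ExponentialBound μ₀ H β₀ K)
    (h4 : EnergyEntropyCompact μ₀ H E) {β : ℝ} (hβ : β₀ < β)
    {φ : ℕ → ℕ+} (hφ : StrictMono φ) (ν : (k : ℕ) → ProbabilityMeasure (Fin (φ k) → X))
    (hsym : ∀ k, IsSymmetric (ν k)) (hkl : ∀ k, relEntropy (ν k) (prodMeasure (φ k) μ₀) ≠ ∞)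
    {c : ℕ → ℝ} {c₀ : ℝ}
    (hc : ∀ k, β * realEnergy H (φ k) (ν k) + realEntropy μ₀ (φ k) (ν k) ≤ c k)
    (hc₀ : Tendsto c atTop (𝓝 c₀)) {Γ : ProbabilityMeasure (ProbabilityMeasure X)}
    (hΓ : Tendsto (fun k => empiricalLaw (φ k) (ν k)) atTop (𝓝 Γ))
    {s : Set (ProbabilityMeasure X)} (hs : ∀ᵐ μ ∂(Γ : Measure (ProbabilityMeasure X)), μ ∈ s) :
    ∃ μ ∈ s, scaledFreeEnergy μ₀ E β μ ≤ (c₀ : EReal) := by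
  obtain ⟨M, hM⟩ := hc₀.bddAbove_range
  obtain ⟨C, hC⟩ := B.exists_realEntropy_le hβ M
  obtain ⟨hEae, hEi, hElim⟩ := tendsto_realEnergy B h4 hφ ν hsym hkl
    (fun k => hC _ _ (hkl k) ((hc k).trans (hM ⟨k, rfl⟩))) hΓ
  set e := ∫ μ, (E μ).toReal ∂(Γ : Measure (ProbabilityMeasure X)) with he
  have hdlim : Tendsto (fun k => c k - β * realEnergy H (φ k) (ν k)) atTop (𝓝 (c₀ - β * e)) :=
    hc₀.sub (hElim.const_mul β)
  have hdle : ∀ k, realEntropy μ₀ (φ k) (ν k) ≤ c k - β * realEnergy H (φ k) (ν k) := fun k => by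
    linarith [hc k]
  have hD0 : 0 ≤ c₀ - β * e :=
    ge_of_tendsto' hdlim fun k => (realEntropy_nonneg _ _ _).trans (hdle k)
  set S : ProbabilityMeasure X → ℝ≥0∞ := fun μ => ⨆ n, ENNReal.ofReal (entropyApprox μ₀ n μ)
    with hS
  have hSm : Measurable S := Measurable.iSup fun n =>
    (continuous_entropyApprox μ₀ n).measurable.ennreal_ofReal
  have hSint : ∫⁻ μ, S μ ∂(Γ : Measure (ProbabilityMeasure X)) ≤ ENNReal.ofReal (c₀ - β * e) :=
    lintegral_iSup_entropyApprox_le (tendsto_atTop_of_strictMono hφ) ν hkl hdle hdlim hΓ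
  have hSfin : ∫⁻ μ, S μ ∂(Γ : Measure (ProbabilityMeasure X)) ≠ ∞ :=
    ne_top_of_le_ne_top ENNReal.ofReal_ne_top hSint
  have hSae := ae_lt_top hSm hSfin
  have hSi : Integrable (fun μ => (S μ).toReal) (Γ : Measure (ProbabilityMeasure X)) :=
    integrable_toReal_of_lintegral_ne_top hSm.aemeasurable hSfin
  have hSle : ∫ μ, (S μ).toReal ∂(Γ : Measure (ProbabilityMeasure X)) ≤ c₀ - β * e := by
    rw [integral_toReal hSm.aemeasurable hSae]
    exact ENNReal.toReal_le_of_le_ofReal hD0 hSint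
  -- The free energy `β E + S` has `Γ`-mean at most `c₀`, so it is at most `c₀` at some point of any
  -- set of full measure.
  have hnull := ae_iff.1 (hs.and (hEae.and hSae))
  obtain ⟨μ, hμ, hle⟩ := exists_notMem_null_le_integral ((hEi.const_mul β).add hSi) hnull
  simp only [mem_ofPred_eq, not_not] at hμ
  obtain ⟨hμs, hμE, hμS⟩ := hμ
  refine ⟨μ, hμs, ?_⟩
  have hDS : relEntropy μ μ₀ ≤ S μ := klDiv_le_iSup_entropyApprox μ₀ μ
  have hD : relEntropy μ μ₀ ≠ ∞ := ne_top_of_le_ne_top hμS.ne hDS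
  rw [scaledFreeEnergy_eq_coe hD hμE, EReal.coe_le_coe_iff]
  have h1 : (relEntropy μ μ₀).toReal ≤ (S μ).toReal := ENNReal.toReal_mono hμS.ne hDS
  have h2 : ∫ μ, ((fun μ => β * (E μ).toReal) + fun μ => (S μ).toReal) μ
      ∂(Γ : Measure (ProbabilityMeasure X)) =
      β * e + ∫ μ, (S μ).toReal ∂(Γ : Measure (ProbabilityMeasure X)) := by
    rw [he, ← integral_const_mul]
    exact integral_add (hEi.const_mul β) hSi
  rw [h2, Pi.add_apply] at hle
  linarith

lemma scaledFreeEnergy_ne_bot (B : ExponentialBound μ₀ H β₀ K) (h4 : EnergyEntropyCompact μ₀ H E)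
    (β : ℝ) (μ : ProbabilityMeasure X) : scaledFreeEnergy μ₀ E β μ ≠ ⊥ := by
  by_cases hμ : relEntropy μ μ₀ = ∞
  · rw [scaledFreeEnergy, if_pos hμ]; exact top_ne_bot
  · rw [scaledFreeEnergy_eq_coe hμ (energy_of_relEntropy_ne_top B h4 hμ).1]
    exact EReal.coe_ne_bot _

/-- Sublevel sets are closed: given `μ_k → μ`, choose `N_k` so large that `μ_k^{⊗N_k}` has almost
the free energy of `μ_k` and its empirical law is close to the Dirac mass at `μ_k`. -/
lemma lowerSemicontinuous_scaledFreeEnergy (B : ExponentialBound μ₀ H β₀ K)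
    (h4 : EnergyEntropyCompact μ₀ H E) {β : ℝ} (hβ : β₀ < β) :
    LowerSemicontinuous (scaledFreeEnergy μ₀ E β) := by
  rw [lowerSemicontinuous_iff_isClosed_preimage]
  intro y
  induction y with
  | bot =>
    have : scaledFreeEnergy μ₀ E β ⁻¹' Iic ⊥ = ∅ := by
      ext μ
      simpa using scaledFreeEnergy_ne_bot B h4 β μ
    rw [this]; exact isClosed_empty
  | top => simp
  | coe c =>
    refine IsSeqClosed.isClosed fun u μ hu hμ => ?_
    have hfin : ∀ k, relEntropy (u k) μ₀ ≠ ∞ := by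
      intro k hk
      have h := hu k
      rw [mem_preimage, scaledFreeEnergy, if_pos hk] at h
      exact EReal.coe_ne_top c (top_le_iff.1 h)
    let _ := TopologicalSpace.metrizableSpaceMetric (ProbabilityMeasure (ProbabilityMeasure X))
    have hev : ∀ k : ℕ, ∀ᶠ N : ℕ+ in atTop,
        dist (empiricalLaw N (prodMeasure N (u k))) (diracProba (u k)) < 1 / ((k : ℝ) + 1) ∧
        β * realEnergy H N (prodMeasure N (u k)) + (relEntropy (u k) μ₀).toReal <
          c + 1 / ((k : ℝ) + 1) := by
      intro k
      have hk : (0 : ℝ) < 1 / ((k : ℝ) + 1) := by positivity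
      obtain ⟨hE, hlim⟩ := energy_of_relEntropy_ne_top B h4 (hfin k)
      have h1 := Metric.tendsto_nhds.1 (tendsto_empiricalLaw_prodMeasure (u k)) _ hk
      have h2 := (hlim.const_mul β).add_const (relEntropy (u k) μ₀).toReal
      have h3 := hu k
      rw [mem_preimage, scaledFreeEnergy_eq_coe (hfin k) hE, mem_Iic, EReal.coe_le_coe_iff] at h3
      exact h1.and (h2.eventually_lt_const (by linarith))
    obtain ⟨φ, hφ, hp⟩ := exists_strictMono_of_forall_eventually hev
    have hk0 : Tendsto (fun k : ℕ => 1 / ((k : ℝ) + 1)) atTop (𝓝 0) :=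
      tendsto_one_div_add_atTop_nhds_zero_nat
    have hlaw : Tendsto (fun k => empiricalLaw (φ k) (prodMeasure (φ k) (u k))) atTop
        (𝓝 (diracProba μ)) := by
      have h1 : Tendsto (fun k => diracProba (u k)) atTop (𝓝 (diracProba μ)) :=
        (continuous_diracProba.tendsto μ).comp hμ
      refine h1.congr_dist ?_
      refine squeeze_zero (fun _ => dist_nonneg) (fun k => ?_) hk0
      rw [dist_comm]
      exact (hp k).1.le
    obtain ⟨μ', hμ', hle⟩ := exists_scaledFreeEnergy_le B h4 hβ hφ
      (fun k => prodMeasure (φ k) (u k)) (fun k => isSymmetric_prodMeasure _ _)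
      (fun k => relEntropy_prodMeasure_ne_top (hfin k) _)
      (c := fun k => c + 1 / ((k : ℝ) + 1)) (c₀ := c)
      (fun k => by rw [realEntropy_prodMeasure]; exact (hp k).2.le)
      (by simpa using hk0.const_add c) hlaw (s := {μ}) (by
        have hd : ((diracProba μ : ProbabilityMeasure (ProbabilityMeasure X)) :
          Measure (ProbabilityMeasure X)) = Measure.dirac μ := rfl
        rw [hd, ae_dirac_eq, eventually_pure]
        exact mem_singleton μ)
    rw [mem_singleton_iff.1 hμ'] at hle
    exact hle

end FreeEnergy

section LargeDeviations

open InformationTheory Real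

variable {X : Type*} [TopologicalSpace X] [CompactSpace X] [TopologicalSpace.MetrizableSpace X]
  [MeasurableSpace X] [BorelSpace X]
  {μ₀ : ProbabilityMeasure X} {H : (N : ℕ+) → (Fin N → X) → EReal}
  {E : ProbabilityMeasure X → EReal} {β₀ : ℝ} {K : ℝ → ℝ}

/-! ### The upper bound -/

lemma abs_mul_exp_le {β ε : ℝ} (hε : 0 < ε) (h : ℝ) :
    |h * exp (-β * h)| ≤ ε⁻¹ * (exp (-(β - ε) * h) + exp (-(β + ε) * h)) := by
  have h1 : ε * |h| ≤ exp (ε * |h|) := by linarith [add_one_le_exp (ε * |h|)]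
  rw [abs_mul, abs_exp, inv_mul_eq_div, le_div_iff₀ hε]
  have h2 : exp (ε * |h|) * exp (-β * h) ≤ exp (-(β - ε) * h) + exp (-(β + ε) * h) := by
    rw [← exp_add]
    rcases abs_cases h with ⟨h', -⟩ | ⟨h', -⟩ <;> rw [h']
    · have : ε * h + -β * h = -(β - ε) * h := by ring
      rw [this]; linarith [exp_pos (-(β + ε) * h)]
    · have : ε * -h + -β * h = -(β + ε) * h := by ring
      rw [this]; linarith [exp_pos (-(β - ε) * h)]
  have h3 := mul_le_mul_of_nonneg_right h1 (exp_pos (-β * h)).le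
  linarith

/-- The Gibbs measure conditioned on `δ_N ∈ F` turns a lower bound on `Γ_N(F)` into an upper bound
on a mean free energy. -/
lemma exists_gibbs_of_lt (B : ExponentialBound μ₀ H β₀ K)
    (hsymm : ∀ (N : ℕ+) (σ : Equiv.Perm (Fin N)) (x : Fin N → X), H N (x ∘ σ) = H N x)
    {β : ℝ} (hβ : β₀ < β) {N : ℕ+} {F : Set (ProbabilityMeasure X)} (hF : MeasurableSet F) {c : ℝ}
    (hc : (c : EReal) < ENNReal.log ((boltzmannMeasure μ₀ H β N).map (empiricalMeasure N) F) /
      (((N : ℕ) : ℝ) : EReal)) :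
    ∃ ν : ProbabilityMeasure (Fin N → X), IsSymmetric ν ∧
      relEntropy ν (prodMeasure N μ₀) ≠ ∞ ∧
      (ν : Measure (Fin N → X)) (empiricalMeasure N ⁻¹' F)ᶜ = 0 ∧
      β * realEnergy H N ν + realEntropy μ₀ N ν ≤ -c := by
  have hN : (0 : ℝ) < (N : ℕ) := by exact_mod_cast N.pos
  set A := empiricalMeasure N ⁻¹' F with hAdef
  have hA : MeasurableSet A := measurable_empiricalMeasure N hF
  rw [Measure.map_apply (measurable_empiricalMeasure N) hF, B.boltzmannMeasure_apply hβ N hA] at hc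
  set Z := ∫ x in A, exp (-β * (H N x).toReal) ∂(prodMeasure N μ₀ : Measure (Fin N → X)) with hZ
  have hZpos : 0 < Z := by
    by_contra hneg
    rw [ENNReal.ofReal_of_nonpos (not_lt.1 hneg), ENNReal.log_zero,
      EReal.bot_div_of_pos_ne_top (by exact_mod_cast hN) (EReal.coe_ne_top _)] at hc
    exact not_lt_bot hc
  rw [ENNReal.log_ofReal_of_pos hZpos, ← EReal.coe_div, EReal.coe_lt_coe_iff] at hc
  have hye : Integrable (fun x => -β * (H N x).toReal * exp (-β * (H N x).toReal))
      (prodMeasure N μ₀ : Measure (Fin N → X)) := by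
    have hε : 0 < (β - β₀) / 2 := by linarith
    have h1 : Integrable (fun x => (H N x).toReal * exp (-β * (H N x).toReal))
        (prodMeasure N μ₀ : Measure (Fin N → X)) := by
      refine Integrable.mono' (((B.integrable_exp (β := β - (β - β₀) / 2) (by linarith) N).add
        (B.integrable_exp (β := β + (β - β₀) / 2) (by linarith) N)).const_mul
          ((β - β₀) / 2)⁻¹) ?_ (Eventually.of_forall fun x => abs_mul_exp_le hε _)
      exact ((B.aemeasurable_toReal N).mul
        ((B.aemeasurable_toReal N).const_mul _).exp).aestronglyMeasurable
    refine (h1.const_mul (-β)).congr (Eventually.of_forall fun x => ?_)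
    show -β * ((H N x).toReal * exp (-β * (H N x).toReal)) = _
    ring
  obtain ⟨ν, hν, hprob, hνA, hkl, hle⟩ := exists_gibbs_measure hA
    (B.integrable_exp hβ N).integrableOn hye.integrableOn hZpos
  obtain ⟨ν', rfl⟩ : ∃ ν' : ProbabilityMeasure (Fin N → X), (ν' : Measure (Fin N → X)) = ν :=
    ⟨⟨ν, hprob⟩, rfl⟩
  refine ⟨ν', isSymmetric_of_eq_withDensity (μ := μ₀) hν fun σ x => ?_, hkl, hνA, ?_⟩
  · have hx : x ∘ σ ∈ A ↔ x ∈ A := by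
      rw [hAdef, mem_preimage, mem_preimage, empiricalMeasure_comp_perm]
    by_cases hxA : x ∈ A
    · simp [hxA, hx.2 hxA, hsymm]
    · simp [hxA, mt hx.1 hxA]
  · rw [integral_const_mul, ← hZ] at hle
    rw [realEnergy, realEntropy, relEntropy, ← mul_div_assoc, ← add_div, div_le_iff₀ hN]
    rw [lt_div_iff₀ hN] at hc
    linarith

/-- If the bound failed, conditioned Gibbs measures along a subsequence would have free energies at
most `-c < inf_F I`, while a limit of their empirical laws is carried by `F`. -/
lemma limsup_log_le (B : ExponentialBound μ₀ H β₀ K) (h4 : EnergyEntropyCompact μ₀ H E)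
    (hsymm : ∀ (N : ℕ+) (σ : Equiv.Perm (Fin N)) (x : Fin N → X), H N (x ∘ σ) = H N x)
    {β : ℝ} (hβ : β₀ < β) {F : Set (ProbabilityMeasure X)} (hF : IsClosed F) :
    limsup (fun N : ℕ+ => ENNReal.log ((boltzmannMeasure μ₀ H β N).map (empiricalMeasure N) F) /
      (((N : ℕ) : ℝ) : EReal)) atTop ≤ -(⨅ μ ∈ F, scaledFreeEnergy μ₀ E β μ) := by
  by_contra hlt
  obtain ⟨c, hc, hc'⟩ := EReal.lt_iff_exists_real_btwn.1 (not_le.1 hlt)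
  obtain ⟨φ, hφ, hp⟩ := exists_strictMono_of_frequently (frequently_lt_of_lt_limsup (h := hc'))
  choose ν hsym hkl hνF hle using fun k => exists_gibbs_of_lt B hsymm hβ hF.measurableSet (hp k)
  obtain ⟨Γ, ψ, hψ, hΓ⟩ := CompactSpace.tendsto_subseq fun k => empiricalLaw (φ k) (ν k)
  have hΓF : ∀ᵐ μ ∂(Γ : Measure (ProbabilityMeasure X)), μ ∈ F := by
    have h1 := ProbabilityMeasure.limsup_measure_closed_le_of_tendsto hΓ hF
    have h2 : ∀ k, (empiricalLaw (φ k) (ν k) : Measure (ProbabilityMeasure X)) F = 1 := fun k => by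
      rw [empiricalLaw_apply _ hF.measurableSet]
      exact (prob_compl_eq_zero_iff (measurable_empiricalMeasure _ hF.measurableSet)).1 (hνF k)
    simp only [Function.comp_apply, h2, limsup_const] at h1
    exact (prob_compl_eq_zero_iff hF.measurableSet).2 (le_antisymm prob_le_one h1)
  obtain ⟨μ, hμF, hμ⟩ := exists_scaledFreeEnergy_le B h4 hβ (hφ.comp hψ) (fun k => ν (ψ k))
    (fun k => hsym _) (fun k => hkl _) (fun k => hle _) tendsto_const_nhds hΓ hΓF
  have h3 : ⨅ μ ∈ F, scaledFreeEnergy μ₀ E β μ ≤ ((-c : ℝ) : EReal) :=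
    (iInf₂_le μ hμF).trans hμ
  rw [EReal.neg_lt_comm, ← EReal.coe_neg] at hc
  exact absurd hc (not_lt.2 h3)

/-! ### The lower bound -/

lemma tendsto_empiricalLaw_prodMeasure_apply {μ : ProbabilityMeasure X}
    {U : Set (ProbabilityMeasure X)} (hU : IsOpen U) (hμ : μ ∈ U) :
    Tendsto (fun N : ℕ+ => (empiricalLaw N (prodMeasure N μ) : Measure (ProbabilityMeasure X)) U)
      atTop (𝓝 1) := by
  have h := ProbabilityMeasure.le_liminf_measure_open_of_tendsto
    (tendsto_empiricalLaw_prodMeasure μ) hU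
  have hd : (diracProba μ : Measure (ProbabilityMeasure X)) U = 1 := by
    have : (diracProba μ : Measure (ProbabilityMeasure X)) = Measure.dirac μ := rfl
    rw [this, Measure.dirac_apply_of_mem hμ]
  rw [hd] at h
  exact tendsto_of_le_liminf_of_limsup_le h
    (limsup_le_of_le (by isBoundedDefault) (Eventually.of_forall fun N => prob_le_one))

/-- The product measure `μ^{⊗N}` conditioned on `δ_N ∈ G`. -/
lemma exists_conditioned_prodMeasure {μ : ProbabilityMeasure X} (hμ : relEntropy μ μ₀ ≠ ∞)
    {G : Set (ProbabilityMeasure X)} (hG : MeasurableSet G) {N : ℕ+}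
    (hp : 0 < (empiricalLaw N (prodMeasure N μ) : Measure (ProbabilityMeasure X)).real G) :
    ∃ ν : ProbabilityMeasure (Fin N → X), IsSymmetric ν ∧
      relEntropy ν (prodMeasure N μ₀) ≠ ∞ ∧
      (ν : Measure (Fin N → X)) (empiricalMeasure N ⁻¹' G)ᶜ = 0 ∧
      realEntropy μ₀ N ν ≤ (relEntropy μ μ₀).toReal /
        (empiricalLaw N (prodMeasure N μ) : Measure (ProbabilityMeasure X)).real G +
        (1 - log ((empiricalLaw N (prodMeasure N μ) : Measure (ProbabilityMeasure X)).real G)) /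
          (N : ℕ) ∧
      ∀ U, MeasurableSet U →
        (empiricalLaw N (prodMeasure N μ) : Measure (ProbabilityMeasure X)) (G ∩ U) ≤
          (empiricalLaw N ν : Measure (ProbabilityMeasure X)) U := by
  have hN : (0 : ℝ) < (N : ℕ) := by exact_mod_cast N.pos
  set A := empiricalMeasure N ⁻¹' G with hAdef
  have hA : MeasurableSet A := measurable_empiricalMeasure N hG
  have hpA : (empiricalLaw N (prodMeasure N μ) : Measure (ProbabilityMeasure X)).real G =
      (prodMeasure N μ : Measure (Fin N → X)).real A := by
    rw [measureReal_def, measureReal_def, empiricalLaw_apply _ hG]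
  rw [hpA] at hp ⊢
  have hA0 : (prodMeasure N μ : Measure (Fin N → X)) A ≠ 0 := by
    rw [measureReal_def] at hp
    exact (ENNReal.toReal_pos_iff.1 hp).1.ne'
  obtain ⟨hkl, hle⟩ := klDiv_cond_le (relEntropy_prodMeasure_ne_top hμ N) hA hp
  obtain ⟨ν, hν⟩ : ∃ ν : ProbabilityMeasure (Fin N → X), (ν : Measure (Fin N → X)) =
      ProbabilityTheory.cond (prodMeasure N μ : Measure (Fin N → X)) A :=
    ⟨⟨_, ProbabilityTheory.cond_isProbabilityMeasure hA0⟩, rfl⟩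
  rw [← hν] at hkl hle
  refine ⟨ν, ?_, hkl, ?_, ?_, fun U hU => ?_⟩
  · refine isSymmetric_of_eq_cond (isSymmetric_prodMeasure N μ) hA (fun σ x => ?_) hν
    rw [hAdef, mem_preimage, mem_preimage, empiricalMeasure_comp_perm]
  · rw [hν, ProbabilityTheory.cond_apply hA, inter_compl_self, measure_empty, mul_zero]
  · have h1 : (klDiv (prodMeasure N μ : Measure (Fin N → X))
        (prodMeasure N μ₀ : Measure (Fin N → X))).toReal = (N : ℕ) * (relEntropy μ μ₀).toReal := by
      have := congrArg ENNReal.toReal (relEntropy_prodMeasure μ₀ μ N)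
      rwa [ENNReal.toReal_mul, ENNReal.toReal_natCast] at this
    rw [h1] at hle
    rw [realEntropy, div_le_iff₀ hN]
    refine hle.trans (le_of_eq ?_)
    field_simp
    ring
  · rw [empiricalLaw_apply _ hU, empiricalLaw_apply _ (hG.inter hU), preimage_inter, hν,
      ProbabilityTheory.cond_apply hA]
    exact le_mul_of_one_le_left (zero_le) (ENNReal.one_le_inv.2 prob_le_one)

lemma neg_iInf_le_liminf_log (B : ExponentialBound μ₀ H β₀ K) (h4 : EnergyEntropyCompact μ₀ H E)
    {β : ℝ} (hβ : β₀ < β) {G : Set (ProbabilityMeasure X)} (hG : IsOpen G) :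
    -(⨅ μ ∈ G, scaledFreeEnergy μ₀ E β μ) ≤
      liminf (fun N : ℕ+ => ENNReal.log ((boltzmannMeasure μ₀ H β N).map (empiricalMeasure N) G) /
        (((N : ℕ) : ℝ) : EReal)) atTop := by
  rw [EReal.neg_le]
  refine le_iInf₂ fun μ hμG => ?_
  by_cases hμ : relEntropy μ μ₀ = ∞
  · rw [scaledFreeEnergy, if_pos hμ]; exact le_top
  rw [EReal.neg_le]
  by_contra hlt
  obtain ⟨c, hc, hc'⟩ := EReal.lt_iff_exists_real_btwn.1 (not_le.1 hlt)
  have hGm := hG.measurableSet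
  have hp1 : Tendsto (fun N : ℕ+ => (empiricalLaw N (prodMeasure N μ) :
      Measure (ProbabilityMeasure X)).real G) atTop (𝓝 1) := by
    have := (ENNReal.tendsto_toReal ENNReal.one_ne_top).comp
      (tendsto_empiricalLaw_prodMeasure_apply hG hμG)
    exact this
  obtain ⟨φ, hφ, hp⟩ := exists_strictMono_of_frequently
    ((frequently_lt_of_liminf_lt (h := hc)).and_eventually (hp1.eventually_const_lt one_pos))
  have hφ' := tendsto_atTop_of_strictMono hφ
  choose ν hsym hkl hνG hent hlaw using fun k =>
    exists_conditioned_prodMeasure hμ hGm (hp k).2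
  have hlim : Tendsto (fun k => empiricalLaw (φ k) (ν k)) atTop (𝓝 (diracProba μ)) := by
    refine tendsto_of_forall_isOpen_le_liminf' fun U hU => ?_
    have hd : (diracProba μ : Measure (ProbabilityMeasure X)) = Measure.dirac μ := rfl
    by_cases hμU : μ ∈ U
    · rw [hd, Measure.dirac_apply_of_mem hμU]
      have h1 := (tendsto_empiricalLaw_prodMeasure_apply (hG.inter hU) ⟨hμG, hμU⟩).comp hφ'
      rw [← h1.liminf_eq]
      exact liminf_le_liminf (Eventually.of_forall fun k => hlaw k U hU.measurableSet)
    · rw [hd, Measure.dirac_apply' _ hU.measurableSet, indicator_of_notMem hμU]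
      exact zero_le
  set p : ℕ → ℝ := fun k => (empiricalLaw (φ k) (prodMeasure (φ k) μ) :
      Measure (ProbabilityMeasure X)).real G with hpdef
  have hplim : Tendsto p atTop (𝓝 1) := hp1.comp hφ'
  have hφr : Tendsto (fun k => ((φ k : ℕ) : ℝ)) atTop atTop :=
    tendsto_natCast_atTop_atTop.comp (tendsto_PNat_val_atTop_atTop.comp hφ')
  have hdlim : Tendsto (fun k => (relEntropy μ μ₀).toReal / p k + (1 - log (p k)) / (φ k : ℕ))
      atTop (𝓝 (relEntropy μ μ₀).toReal) := by
    have h1 : Tendsto (fun k => (relEntropy μ μ₀).toReal / p k) atTop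
        (𝓝 ((relEntropy μ μ₀).toReal / 1)) := tendsto_const_nhds.div hplim one_ne_zero
    have h2 : Tendsto (fun k => 1 - log (p k)) atTop (𝓝 (1 - log 1)) :=
      (hplim.log one_ne_zero).const_sub 1
    simpa using h1.add (h2.div_atTop hφr)
  obtain ⟨M, hM⟩ := hdlim.bddAbove_range
  obtain ⟨-, -, hElim⟩ := tendsto_realEnergy B h4 hφ ν hsym hkl
    (fun k => (hent k).trans (hM ⟨k, rfl⟩)) hlim
  have hd : ((diracProba μ : ProbabilityMeasure (ProbabilityMeasure X)) :
    Measure (ProbabilityMeasure X)) = Measure.dirac μ := rfl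
  rw [hd, integral_dirac] at hElim
  have hkey : ∀ k, -c ≤ β * realEnergy H (φ k) (ν k) +
      ((relEntropy μ μ₀).toReal / p k + (1 - log (p k)) / (φ k : ℕ)) := by
    intro k
    have hN : (0 : ℝ) < (φ k : ℕ) := by exact_mod_cast (φ k).pos
    have hA : MeasurableSet (empiricalMeasure (φ k) ⁻¹' G) := measurable_empiricalMeasure _ hGm
    have h1 := B.neg_log_div_le hβ (hkl k) hA (hνG k)
    have h2 := (hp k).1
    rw [Measure.map_apply (measurable_empiricalMeasure _) hGm,
      B.boltzmannMeasure_apply hβ _ hA] at h2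
    have hρA : (prodMeasure (φ k) μ₀ : Measure (Fin (φ k) → X))
        (empiricalMeasure (φ k) ⁻¹' G) ≠ 0 := by
      intro h0
      have h3 := (klDiv_ne_top_iff.1 (hkl k)).1 h0
      have h4 := (prob_compl_eq_zero_iff hA).1 (hνG k)
      rw [h3] at h4
      exact zero_ne_one h4
    have : NeZero ((prodMeasure (φ k) μ₀ : Measure (Fin (φ k) → X)).restrict
      (empiricalMeasure (φ k) ⁻¹' G)) := ⟨by simpa [Measure.restrict_eq_zero] using hρA⟩
    rw [ENNReal.log_ofReal_of_pos (integral_exp_pos (B.integrable_exp hβ _).integrableOn),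
      ← EReal.coe_div, EReal.coe_lt_coe_iff] at h2
    have h3 : realEntropy μ₀ (φ k) (ν k) ≤
      (relEntropy μ μ₀).toReal / p k + (1 - log (p k)) / (φ k : ℕ) := hent k
    linarith
  have hfinal : -c ≤ β * (E μ).toReal + (relEntropy μ μ₀).toReal :=
    ge_of_tendsto' ((hElim.const_mul β).add hdlim) hkey
  rw [scaledFreeEnergy_eq_coe hμ (energy_of_relEntropy_ne_top B h4 hμ).1, ← EReal.coe_neg,
    EReal.coe_lt_coe_iff] at hc'
  linarith

/-! ### Exponential bounds and large deviations -/

lemma exists_exponentialBound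
    (hH : ∀ N, AEMeasurable (H N) (prodMeasure N μ₀ : Measure (Fin N → X))) (hβ₀ : β₀ < 0)
    (h : ∀ β : ℝ, β₀ < β → ∃ C : ℝ≥0, ∀ N : ℕ+,
      partitionFunction μ₀ H β N ≤ (C : ℝ≥0∞) ^ (N : ℕ)) :
    ∃ K, ExponentialBound μ₀ H β₀ K := by
  choose! C hC using h
  refine ⟨fun β => log (max (C β : ℝ) 1), hH, hβ₀, fun β hβ N => (hC β hβ N).trans ?_⟩
  have h1 : (0 : ℝ) < max (C β : ℝ) 1 := lt_max_of_lt_right one_pos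
  rw [exp_nat_mul, exp_log h1, ENNReal.ofReal_pow h1.le]
  gcongr
  rw [← ENNReal.ofReal_coe_nnreal]
  exact ENNReal.ofReal_le_ofReal (le_max_left _ _)

/-- A large deviation principle on a compact space bounds the total masses exponentially. -/
lemma exists_le_pow_of_satisfiesLDP {I : ProbabilityMeasure X → EReal} {β : ℝ}
    (hfin : ∀ N : ℕ+, partitionFunction μ₀ H β N < ∞)
    (hI : SatisfiesLDP (fun N => (boltzmannMeasure μ₀ H β N).map (empiricalMeasure N))
      (fun N => ((N : ℕ) : ℝ)) I) :
    ∃ C : ℝ≥0, ∀ N : ℕ+, partitionFunction μ₀ H β N ≤ (C : ℝ≥0∞) ^ (N : ℕ) := by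
  have hZ : ∀ N : ℕ+, (boltzmannMeasure μ₀ H β N).map (empiricalMeasure N) univ =
      partitionFunction μ₀ H β N := fun N => by
    rw [Measure.map_apply (measurable_empiricalMeasure N) MeasurableSet.univ, preimage_univ,
      boltzmannMeasure, withDensity_apply _ MeasurableSet.univ, setLIntegral_univ,
      partitionFunction]
  -- The infimum of the rate functional is attained by compactness, so it is not `-∞`.
  obtain ⟨μ, -, hμ⟩ := LowerSemicontinuousOn.exists_isMinOn ⟨μ₀, mem_univ μ₀⟩ isCompact_univ
    (hI.lowerSemicontinuous.lowerSemicontinuousOn univ)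
  have hinf : I μ ≤ ⨅ ν ∈ univ, I ν := le_iInf₂ fun ν hν => isMinOn_iff.1 hμ ν hν
  have hlt := (hI.upper_bound univ isClosed_univ).trans (EReal.neg_le_neg_iff.2 hinf)
  have htop : -I μ < ⊤ := by
    rw [lt_top_iff_ne_top, Ne, EReal.neg_eq_top_iff]
    exact hI.ne_bot μ
  obtain ⟨c, hc, -⟩ := EReal.lt_iff_exists_real_btwn.1 (hlt.trans_lt htop)
  have hev := eventually_lt_of_limsup_lt hc
  obtain ⟨N₀, hN₀⟩ := eventually_atTop.1 hev
  set S : ℝ≥0 := ∑ N ∈ Finset.Iic N₀, (partitionFunction μ₀ H β N).toNNReal with hS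
  refine ⟨max (Real.toNNReal (exp c)) (max S 1), fun N => ?_⟩
  rcases le_total N N₀ with hN | hN
  · have h1 : (partitionFunction μ₀ H β N).toNNReal ≤ S :=
      Finset.single_le_sum (f := fun N => (partitionFunction μ₀ H β N).toNNReal)
        (fun _ _ => zero_le) (Finset.mem_Iic.2 hN)
    have h2 : max S 1 ≤ max (Real.toNNReal (exp c)) (max S 1) := le_max_right _ _
    have h3 : (partitionFunction μ₀ H β N).toNNReal ≤
        max (Real.toNNReal (exp c)) (max S 1) ^ (N : ℕ) :=
      (h1.trans ((le_max_left _ _).trans h2)).trans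
        (le_self_pow₀ ((le_max_right _ _).trans h2) N.ne_zero)
    rw [← ENNReal.coe_toNNReal (hfin N).ne]
    exact_mod_cast h3
  · have h1 := hN₀ N hN
    have hNpos : (0 : EReal) < (((N : ℕ) : ℝ) : EReal) := by exact_mod_cast N.pos
    simp only [hZ] at h1
    have h2 : ENNReal.log (partitionFunction μ₀ H β N) ≤ ((c * (N : ℕ) : ℝ) : EReal) := by
      rw [EReal.coe_mul, mul_comm]
      exact (EReal.div_le_iff_le_mul hNpos (EReal.coe_ne_top _)).1 h1.le
    have h3 : partitionFunction μ₀ H β N ≤ ENNReal.ofReal (exp (c * (N : ℕ))) := by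
      rw [← ENNReal.log_le_log_iff, ENNReal.log_ofReal_of_pos (exp_pos _), log_exp]
      exact h2
    refine h3.trans ?_
    rw [mul_comm, exp_nat_mul, ENNReal.ofReal_pow (exp_pos _).le]
    gcongr
    rw [ENNReal.ofReal]
    exact_mod_cast le_max_left _ _

end LargeDeviations

end GibbsLDP

theorem theorem1p3 {X : Type*} [TopologicalSpace X] [CompactSpace X]
    [TopologicalSpace.MetrizableSpace X] [MeasurableSpace X] [BorelSpace X]
    (μ₀ : ProbabilityMeasure X)
    (H : (N : ℕ+) → (Fin N → X) → EReal)
    (hH_meas : ∀ N, AEMeasurable (H N) (GibbsLDP.prodMeasure N μ₀ : Measure (Fin N → X)))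
    (hH_symm : ∀ (N : ℕ+) (σ : Equiv.Perm (Fin N)) (x : Fin N → X), H N (x ∘ σ) = H N x)
    (E : ProbabilityMeasure X → EReal)
    (h1 : GibbsLDP.HasMacroscopicMeanEnergy μ₀ H E)
    (h4 : GibbsLDP.EnergyEntropyCompact μ₀ H E)
    (β₀ : ℝ) (hβ₀ : β₀ < 0) :
    (∀ β : ℝ, β₀ < β → ∃ C : ℝ≥0, ∀ N : ℕ+,
        GibbsLDP.partitionFunction μ₀ H β N ≤ (C : ℝ≥0∞) ^ (N : ℕ)) ↔
      (∀ β : ℝ, β₀ < β →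
        (∀ N : ℕ+, GibbsLDP.partitionFunction μ₀ H β N < ∞) ∧
        GibbsLDP.SatisfiesLDP
          (fun N => (GibbsLDP.boltzmannMeasure μ₀ H β N).map (GibbsLDP.empiricalMeasure N))
          (fun N => ((N : ℕ) : ℝ))
          (GibbsLDP.scaledFreeEnergy μ₀ E β)) := by
  constructor
  · intro h β hβ
    obtain ⟨K, B⟩ := GibbsLDP.exists_exponentialBound hH_meas hβ₀ h
    exact ⟨fun N => (B.bound β hβ N).trans_lt ENNReal.ofReal_lt_top,
      GibbsLDP.lowerSemicontinuous_scaledFreeEnergy B h4 hβ,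
      GibbsLDP.scaledFreeEnergy_ne_bot B h4 β,
      fun F hF => GibbsLDP.limsup_log_le B h4 hH_symm hβ hF,
      fun G hG => GibbsLDP.neg_iInf_le_liminf_log B h4 hβ hG⟩
  · intro h β hβ
    exact GibbsLDP.exists_le_pow_of_satisfiesLDP (h β hβ).1 (h β hβ).2
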